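/- In the deterministic $\mathsf{LOCAL}$ model, the network is an $n$-vertex graph $G$ whose vertices carry distinct identifiers in $\{1,\dots,\lfloor n^c\rfloor\}$, where $c\ge 1$ is a constant. Each vertex initially knows only its own identifier (and the parameters $n,q,c$). In synchronous rounds the vertices exchange messages of unbounded size with their neighbors and perform unrestricted local computation. After a fixed number of rounds, the round complexity, each vertex outputs its part of the solution. The maximum average degree $\mathrm{mad}(G)$ is the maximum, over all subgraphs $H$ of $G$, of the average degree of $H$, which is $2|E(H)|/|V(H)|$ if $H$ is non-empty and $0$ otherwise. The girth of $G$ is the length of a shortest cycle of $G$ ($+\infty$ if $G$ is acyclic). A $(p\!:\!q)$-coloring of $G$ assigns to each vertex a $q$-element subset of $\{1,\dots,p\}$ such that adjacent vertices receive disjoint subsets. **Theorem.** For every constant $c\ge 1$ there is a constant $C$, depending only on $c$, such that for all integers $q\ge 1$ and all $n$ there is a deterministic algorithm in the $\mathsf{LOCAL}$ model, of round complexity at most $C\,(q\log n+q^2)$, with the following property: for every $n$-vertex graph $G$ with girth at least $2q+2$ and $\mathrm{mad}(G)\le 2+\frac{1}{40q}$, and every assignment of distinct identifiers in $\{1,\dots,\lfloor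 n^c\rfloor\}$ to the vertices of $G$, the sets output by the vertices form a $(2q+1\!:\!q)$-coloring of $G$. (For $n=0$, read $\log n$ as $0$.) -/

import Mathlib

namespace LocalFrac

universe u

/-- The average degree `2|E| / |V|` of a finite graph; since `x / 0 = 0`, it is `0` when `V` is
empty. -/
noncomputable def avgDegree {V : Type u} (G : SimpleGraph V) : ℝ :=
  2 * (G.edgeSet.ncard : ℝ) / (Nat.card V : ℝ)

/-- The maximum average degree of a finite graph: the maximum of the average degrees of its
subgraphs. (A finite graph has finitely many subgraphs, so the supremum is a maximum.) -/
noncomputable def mad {V : Type u} (G : SimpleGraph V) : ℝ :=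
  ⨆ H : G.Subgraph, avgDegree H.coe

/-- A `(p : q)`-coloring: every vertex gets a `q`-element subset of a `p`-element set of colors,
and adjacent vertices get disjoint subsets. -/
def IsPQColoring {V : Type u} (G : SimpleGraph V) (p q : ℕ) (f : V → Finset (Fin p)) : Prop :=
  (∀ v, (f v).card = q) ∧ ∀ u v, G.Adj u v → Disjoint (f u) (f v)

/-- A deterministic algorithm in the LOCAL model with outputs in `Out`. A vertex starts with its own
identifier as its only information about the network. In each synchronous round every vertex sends
a message (of unbounded size) to its neighbors and updates its state from the messages that it
receives. After a fixed number `rounds` of rounds every vertex computes its output from its state.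
Local computation is unrestricted. (As messages are unbounded and may contain the identifier of the
sender as well as messages addressed to particular identifiers, it is no restriction that a vertex
sends the same message to all its neighbors and receives an unordered collection.) -/
structure LocalAlgorithm (Out : Type) where
  /-- the internal states of a vertex -/
  State : Type
  /-- the possible messages -/
  Msg : Type
  /-- the initial state, computed from the identifier -/
  init : ℕ → State
  /-- the message sent to the neighbors in a round -/
  send : State → Msg
  /-- the new state, computed from the old one and the messages received in the round -/
  receive : State → Multiset Msg → State
  /-- the round complexity -/
  rounds : ℕ
  /-- the output, computed from the final state -/
  output : State → Out

namespace LocalAlgorithm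

variable {Out : Type} {V : Type u}

open Classical in
/-- The state of every vertex after `t` rounds of `A` on `G` with identifiers `ident`. -/
noncomputable def stateAfter [Fintype V] (A : LocalAlgorithm Out) (G : SimpleGraph V)
    (ident : V → ℕ) : ℕ → V → A.State
  | 0, v => A.init (ident v)
  | t + 1, v => A.receive (A.stateAfter G ident t v)
      ((G.neighborFinset v).val.map fun w => A.send (A.stateAfter G ident t w))

/-- The output of every vertex when `A` is run on `G` with identifiers `ident`. -/
noncomputable def run [Fintype V] (A : LocalAlgorithm Out) (G : SimpleGraph V)
    (ident : V → ℕ) (v : V) : Out :=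
  A.output (A.stateAfter G ident A.rounds v)

end LocalAlgorithm

/-- Admissible identifiers on a graph with `n` vertices: pairwise distinct integers between `1` and
`n ^ c`. -/
def IsIdentifierAssignment {V : Type u} [Fintype V] (c : ℝ) (ident : V → ℕ) : Prop :=
  Function.Injective ident ∧
    ∀ v, 1 ≤ ident v ∧ (ident v : ℝ) ≤ (Fintype.card V : ℝ) ^ c

end LocalFrac

/-!
Replace every vertex by its identifier, so that the network is a graph on `ℕ`. In `T + 1` rounds a
vertex learns all edges that meet its ball of radius `T`, so every function of graphs and vertices
that depends only on the `T`-balls (`IsLocal T`) can be computed in `T + 1` rounds (`run_gather`).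
It remains to find a local function that is a proper coloring.

Edges are deleted in phases. A phase first rakes `q` times, that is, deletes the edges at the
vertices of degree at most one, and then compresses: it deletes the edges at the core, which
consists of the long paths of vertices of degree at most two. The number of leaves does not increase
under raking, so either raking isolates many vertices, or there are few leaves in the end. In the
latter case the bound on the average degree makes the sum of the degrees of the vertices of degree
at least three a small multiple of the number of vertices over `q`, and all vertices outside the
core are at distance at most `2q` from such a vertex. Hence a phase isolates a constant fraction of
the vertices (`alive_phase_le`), and `O(log n)` phases delete all edges.

The phases are then undone in reverse order, while the coloring is kept proper. Undoing a rake is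
easy, because the vertices in question have one neighbor (`proper_rakeColor`). To undo a
compression, some vertices of the core, at distance at least `2q` from each other and from the
outside of the core, get a fixed color, and cut the core into paths of length `O(q)`. Any two
vertices of the Kneser graph of the `q`-subsets of a `(2q + 1)`-set are joined by walks of every
length from `2q` on (`exists_kWalk`), so each of the paths can be colored, whatever the colors of
its ends are (`exists_extension`). The girth condition is needed for cycles of the core with a
single cut vertex. All in all this takes `O(q)` rounds for each phase.

The cut vertices form a net of a graph of maximum degree two (`net_separated`, `net_dominating`). It
is obtained from a ruling set, which is computed bit by bit from the identifiers and dominates with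
radius `O(q log n)`, by adding vertices whose distances to it are multiples of `2q`, unless they are
too close to each other. The nets of all phases are computed in parallel, which takes `O(q log n)`
rounds in total (`isLocal_coloring`).
-/

namespace LocalFrac

/-! ### Balls and local functions -/

/-- `Within H r u v` says that the distance of `u` and `v` in `H` is at most `r`. -/
def Within {V : Type*} (H : SimpleGraph V) (r : ℕ) (u v : V) : Prop :=
  ∃ p : H.Walk u v, p.length ≤ r

section Within

variable {V : Type*} {H H' : SimpleGraph V} {r s : ℕ} {u v w : V}

lemma Within.refl (H : SimpleGraph V) (r : ℕ) (u : V) : Within H r u u := ⟨.nil, by simp⟩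

lemma Within.symm (h : Within H r u v) : Within H r v u := by
  obtain ⟨p, hp⟩ := h
  exact ⟨p.reverse, by simpa using hp⟩

lemma Within.trans (h : Within H r u v) (h' : Within H s v w) : Within H (r + s) u w := by
  obtain ⟨p, hp⟩ := h
  obtain ⟨p', hp'⟩ := h'
  exact ⟨p.append p', by rw [SimpleGraph.Walk.length_append]; omega⟩

lemma Within.mono (h : Within H r u v) (hrs : r ≤ s) : Within H s u v := by
  obtain ⟨p, hp⟩ := h
  exact ⟨p, hp.trans hrs⟩

lemma Within.mono_graph (h : Within H r u v) (hH : H ≤ H') : Within H' r u v := by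
  obtain ⟨p, hp⟩ := h
  exact ⟨p.mapLe hH, by simpa using hp⟩

lemma within_of_adj (h : H.Adj u v) : Within H 1 u v := ⟨h.toWalk, by simp⟩

lemma within_zero : Within H 0 u v ↔ u = v := by
  constructor
  · rintro ⟨p, hp⟩
    exact SimpleGraph.Walk.eq_of_length_eq_zero (Nat.le_zero.1 hp)
  · rintro rfl
    exact Within.refl _ _ _

lemma within_succ : Within H (r + 1) u w ↔ Within H r u w ∨ ∃ v, Within H r u v ∧ H.Adj v w := by
  constructor
  · rintro ⟨p, hp⟩
    rcases p.reverse.length.eq_zero_or_pos with h0 | h0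
    · exact .inl ⟨p, by rw [SimpleGraph.Walk.length_reverse] at h0; omega⟩
    · right
      cases hq : p.reverse with
      | nil => simp [hq] at h0
      | cons h q =>
        have : p.length = q.length + 1 := by
          rw [← SimpleGraph.Walk.length_reverse, hq, SimpleGraph.Walk.length_cons]
        exact ⟨_, ⟨q.reverse, by rw [SimpleGraph.Walk.length_reverse]; omega⟩, h.symm⟩
  · rintro (h | ⟨v, h, hv⟩)
    · exact h.mono (Nat.le_succ r)
    · exact h.trans (within_of_adj hv)

/-- A set that contains `u` and is closed under adjacency contains the ball around `u`. -/
lemma Within.mem_of_closed (h : Within H r u v) {Z : Set V} (hu : u ∈ Z)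
    (hZ : ∀ a ∈ Z, ∀ b, H.Adj a b → b ∈ Z) : v ∈ Z := by
  induction r generalizing v with
  | zero => exact within_zero.1 h ▸ hu
  | succ r ih =>
    rcases within_succ.1 h with h | ⟨a, h, ha⟩
    · exact ih h
    · exact hZ a (ih h) v ha

/-- Walks of length at most `r` from `u` stay walks in `H'` if the edges inside the `r`-ball of `u`
are edges of `H'`. -/
lemma Within.transfer (h : Within H r u v)
    (hH : ∀ a b, Within H r u a → Within H r u b → H.Adj a b → H'.Adj a b) : Within H' r u v := by
  induction r generalizing v with
  | zero => exact within_zero.2 (within_zero.1 h)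
  | succ r ih =>
    have hH' : ∀ a b, Within H r u a → Within H r u b → H.Adj a b → H'.Adj a b :=
      fun a b ha hb => hH a b (ha.mono (Nat.le_succ r)) (hb.mono (Nat.le_succ r))
    rcases within_succ.1 h with h' | ⟨a, h', ha⟩
    · exact (ih h' hH').mono (Nat.le_succ r)
    · exact within_succ.2 (.inr ⟨a, ih h' hH', hH a v (h'.mono (Nat.le_succ r)) h ha⟩)

end Within

/-- `Within` is decided inside the ball: if `H` and `H'` have the same neighbors at all vertices of
the `r`-ball of `v` in `H`, then the `s`-balls of `v` coincide for `s ≤ r`. -/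
lemma within_iff_of_agree {H H' : SimpleGraph ℕ} {r s : ℕ} {v a : ℕ} (hs : s ≤ r)
    (h : ∀ a, Within H r v a → H.neighborSet a = H'.neighborSet a) :
    Within H s v a ↔ Within H' s v a := by
  induction s generalizing a with
  | zero => simp [within_zero]
  | succ s ih =>
    rw [within_succ, within_succ, ih (by omega)]
    refine or_congr Iff.rfl (exists_congr fun b => ?_)
    rw [← ih (by omega)]
    refine and_congr_right fun hb => ?_
    have := h b (hb.mono (by omega))
    exact Set.ext_iff.1 this a

/-- A function `Φ` that computes new labels of the vertices from a graph and old labels is a local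
rule of radius `r` if the new label of `v` depends only on the neighborhoods and the labels of the
vertices in the `r`-ball of `v`. -/
def LocalRule {α β : Type*} (r : ℕ) (Φ : SimpleGraph ℕ → (ℕ → α) → ℕ → β) : Prop :=
  ∀ (X X' : SimpleGraph ℕ) (l l' : ℕ → α) (v : ℕ),
    (∀ a, Within X r v a → X.neighborSet a = X'.neighborSet a ∧ l a = l' a) → Φ X l v = Φ X' l' v

/-- A function of the vertices of a graph on `ℕ` is `T`-local if its value at `v` depends only on
the neighborhoods of the vertices in the `T`-ball of `v`. -/
def IsLocal {α : Type*} (T : ℕ) (f : SimpleGraph ℕ → ℕ → α) : Prop :=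
  ∀ (H H' : SimpleGraph ℕ) (v : ℕ),
    (∀ a, Within H T v a → H.neighborSet a = H'.neighborSet a) → f H v = f H' v

/-- A graph operator that deletes edges is `T`-local if the new neighborhoods are. -/
structure IsLocalOp (T : ℕ) (Γ : SimpleGraph ℕ → SimpleGraph ℕ) : Prop where
  le : ∀ H, Γ H ≤ H
  isLocal : IsLocal T fun H v => (Γ H).neighborSet v

lemma IsLocal.mono {α : Type*} {T T' : ℕ} {f : SimpleGraph ℕ → ℕ → α} (h : IsLocal T f)
    (hT : T ≤ T') : IsLocal T' f :=
  fun H H' v hv => h H H' v fun a ha => hv a (ha.mono hT)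

lemma IsLocalOp.mono {T T' : ℕ} {Γ : SimpleGraph ℕ → SimpleGraph ℕ} (h : IsLocalOp T Γ)
    (hT : T ≤ T') : IsLocalOp T' Γ :=
  ⟨h.le, h.isLocal.mono hT⟩

/-- Radii add up when a local rule is applied to a local operator and local labels. -/
lemma LocalRule.isLocal {α β : Type*} {r T : ℕ} {Φ : SimpleGraph ℕ → (ℕ → α) → ℕ → β}
    (hΦ : LocalRule r Φ) {Γ : SimpleGraph ℕ → SimpleGraph ℕ} (hΓ : IsLocalOp T Γ)
    {l : SimpleGraph ℕ → ℕ → α} (hl : IsLocal T l) :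
    IsLocal (T + r) fun H => Φ (Γ H) (l H) := by
  intro H H' v h
  refine hΦ _ _ _ _ v fun a ha => ?_
  have ha' : Within H r v a := ha.mono_graph (hΓ.le H)
  have key : ∀ b, Within H T a b → H.neighborSet b = H'.neighborSet b :=
    fun b hb => h b ((ha'.trans hb).mono (by omega))
  exact ⟨hΓ.isLocal H H' a key, hl H H' a key⟩

lemma IsLocal.comp {α : Type*} {T r : ℕ} {f : SimpleGraph ℕ → ℕ → α} (hf : IsLocal r f)
    {Γ : SimpleGraph ℕ → SimpleGraph ℕ} (hΓ : IsLocalOp T Γ) :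
    IsLocal (T + r) fun H => f (Γ H) := by
  intro H H' v h
  refine hf _ _ v fun a ha => hΓ.isLocal H H' a fun b hb => h b ?_
  exact ((ha.mono_graph (hΓ.le H)).trans hb).mono (by omega)

lemma isLocalOp_id : IsLocalOp 0 fun H => H :=
  ⟨fun _ => le_rfl, fun _ _ v h => h v (Within.refl _ _ _)⟩

lemma IsLocalOp.comp {T r : ℕ} {Γ Γ' : SimpleGraph ℕ → SimpleGraph ℕ} (hΓ' : IsLocalOp r Γ')
    (hΓ : IsLocalOp T Γ) : IsLocalOp (T + r) fun H => Γ' (Γ H) :=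
  ⟨fun H => (hΓ'.le _).trans (hΓ.le H), hΓ'.isLocal.comp hΓ⟩

lemma IsLocalOp.iterate {T : ℕ} {Γ : SimpleGraph ℕ → SimpleGraph ℕ} (hΓ : IsLocalOp T Γ) (j : ℕ) :
    IsLocalOp (j * T) (Γ^[j]) := by
  induction j with
  | zero => rw [Nat.zero_mul]; exact isLocalOp_id
  | succ j ih =>
    have h := hΓ.comp ih
    rw [Function.iterate_succ', Nat.succ_mul]
    exact h

/-- A rule that looks at no labels is the same as a local function. -/
lemma LocalRule.isLocal_self {β α : Type*} {r T : ℕ} {Φ : SimpleGraph ℕ → (ℕ → α) → ℕ → β}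
    (hΦ : LocalRule r Φ) {l : SimpleGraph ℕ → ℕ → α} (hl : IsLocal T l) :
    IsLocal (T + r) fun H => Φ H (l H) :=
  hΦ.isLocal (isLocalOp_id.mono (Nat.zero_le T)) hl

lemma IsLocal.prodMk {α β : Type*} {T : ℕ} {f : SimpleGraph ℕ → ℕ → α}
    {g : SimpleGraph ℕ → ℕ → β} (hf : IsLocal T f) (hg : IsLocal T g) :
    IsLocal T fun H v => (f H v, g H v) :=
  fun H H' v h => Prod.ext (hf H H' v h) (hg H H' v h)

lemma IsLocal.map {α β : Type*} {T : ℕ} {f : SimpleGraph ℕ → ℕ → α} (hf : IsLocal T f)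
    (φ : α → β) : IsLocal T fun H v => φ (f H v) :=
  fun H H' v h => congrArg φ (hf H H' v h)

/-! ### Paths through vertices of degree two -/

/-- A walk that starts on a path whose inner vertices have no neighbors off the path stays on the
path or leaves it through one of its ends; the steps used are accounted for. -/
lemma within_path_or_escape {V : Type*} {H : SimpleGraph V} {p : ℕ → V} {L : ℕ}
    (hp : ∀ i, 0 < i → i < L → ∀ z, H.Adj (p i) z → z = p (i - 1) ∨ z = p (i + 1))
    {i l : ℕ} (hi : i ≤ L) {z : V} (h : Within H l (p i) z) :
    (∃ j, 0 < j ∧ j < L ∧ j ≤ i + l ∧ i ≤ j + l ∧ z = p j) ∨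
      (∃ t, i + t ≤ l ∧ Within H t (p 0) z) ∨ ∃ t, L + t ≤ i + l ∧ Within H t (p L) z := by
  induction l generalizing z with
  | zero =>
    obtain rfl := within_zero.1 h
    rcases Nat.eq_zero_or_pos i with rfl | h0
    · exact .inr (.inl ⟨0, by omega, Within.refl _ _ _⟩)
    · rcases hi.eq_or_lt with rfl | h1
      · exact .inr (.inr ⟨0, by omega, Within.refl _ _ _⟩)
      · exact .inl ⟨i, h0, h1, by omega, by omega, rfl⟩
  | succ l ih =>
    rcases within_succ.1 h with h | ⟨y, h, hy⟩
    · rcases ih h with ⟨j, h1, h2, h3, h4, h5⟩ | ⟨t, h1, h2⟩ | ⟨t, h1, h2⟩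
      · exact .inl ⟨j, h1, h2, by omega, by omega, h5⟩
      · exact .inr (.inl ⟨t, by omega, h2⟩)
      · exact .inr (.inr ⟨t, by omega, h2⟩)
    · rcases ih h with ⟨j, h1, h2, h3, h4, rfl⟩ | ⟨t, h1, h2⟩ | ⟨t, h1, h2⟩
      · have key : ∀ j', (j' = j - 1 ∨ j' = j + 1) → z = p j' →
            (∃ j, 0 < j ∧ j < L ∧ j ≤ i + (l + 1) ∧ i ≤ j + (l + 1) ∧ z = p j) ∨
            (∃ t, i + t ≤ l + 1 ∧ Within H t (p 0) z) ∨
            ∃ t, L + t ≤ i + (l + 1) ∧ Within H t (p L) z := by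
          rintro j' hj' rfl
          rcases Nat.eq_zero_or_pos j' with rfl | h0
          · exact .inr (.inl ⟨0, by omega, Within.refl _ _ _⟩)
          · rcases Nat.lt_or_ge j' L with h1 | h1
            · exact .inl ⟨j', h0, h1, by omega, by omega, rfl⟩
            · obtain rfl : j' = L := by omega
              exact .inr (.inr ⟨0, by omega, Within.refl _ _ _⟩)
        rcases hp j h1 h2 z hy with h | h
        · exact key _ (.inl rfl) h
        · exact key _ (.inr rfl) h
      · exact .inr (.inl ⟨t + 1, by omega, within_succ.2 (.inr ⟨y, h2, hy⟩)⟩)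
      · exact .inr (.inr ⟨t + 1, by omega, within_succ.2 (.inr ⟨y, h2, hy⟩)⟩)

/-- A vertex with at most two neighbors. -/
def DegLeTwo {V : Type*} (H : SimpleGraph V) (v : V) : Prop :=
  ∀ a b c, H.Adj v a → H.Adj v b → H.Adj v c → a ≠ b → c = a ∨ c = b

lemma DegLeTwo.mono {V : Type*} {H H' : SimpleGraph V} {v : V} (h : DegLeTwo H v) (hH : H' ≤ H) :
    DegLeTwo H' v :=
  fun a b c ha hb hc => h a b c (hH ha) (hH hb) (hH hc)

/-- A shortest path, as a sequence of vertices. -/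
lemma Within.exists_geodesic {V : Type*} {H : SimpleGraph V} {r : ℕ} {u v : V}
    (h : Within H r u v) :
    ∃ (p : ℕ → V) (L : ℕ), L ≤ r ∧ p 0 = u ∧ p L = v ∧ (∀ i < L, H.Adj (p i) (p (i + 1))) ∧
      (∀ i j, i ≤ L → j ≤ L → p i = p j → i = j) ∧ ∀ s, Within H s u v → L ≤ s := by
  obtain ⟨w, hw⟩ := h
  obtain ⟨p, hp, hl⟩ := w.reachable.exists_path_of_dist
  refine ⟨p.getVert, p.length, ?_, by simp, by simp, fun i hi => p.adj_getVert_succ hi, ?_, ?_⟩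
  · exact hl ▸ (SimpleGraph.dist_le w).trans hw
  · intro i j hi hj hij
    exact hp.getVert_injOn hi hj hij
  · rintro s ⟨w', hw'⟩
    exact hl ▸ (SimpleGraph.dist_le w').trans hw'

/-- Distances between the vertices of a sequence of consecutive neighbors. -/
lemma within_of_seq {V : Type*} {H : SimpleGraph V} {p : ℕ → V} {L : ℕ}
    (hp : ∀ i < L, H.Adj (p i) (p (i + 1))) (i t : ℕ) (h : i + t ≤ L) :
    Within H t (p i) (p (i + t)) := by
  induction t with
  | zero => exact Within.refl _ _ _
  | succ t ih => exact within_succ.2 (.inr ⟨_, ih (by omega), hp (i + t) (by omega)⟩)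

/-! ### Nets in graphs of maximum degree two -/

/-- One step of the ruling set construction: in each class of vertices whose identifiers agree above
bit `b`, the vertices with bit `b` equal to `0` stay, and the others stay if none of the former is
within distance `k`. -/
def rulingStep (k b : ℕ) (F : SimpleGraph ℕ) (R : ℕ → Prop) (v : ℕ) : Prop :=
  R v ∧ (v.testBit b = true →
    ¬ ∃ u, Within F k v u ∧ R u ∧ u.testBit b = false ∧ u / 2 ^ (b + 1) = v / 2 ^ (b + 1))

/-- The ruling set after the bits below `b` have been treated. -/
def ruling (k : ℕ) : ℕ → SimpleGraph ℕ → ℕ → Prop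
  | 0, _, _ => True
  | b + 1, F, v => rulingStep k b F (ruling k b F) v

lemma localRule_rulingStep (k b : ℕ) : LocalRule k (rulingStep k b) := by
  intro X X' l l' v h
  have hW : ∀ a, Within X k v a ↔ Within X' k v a :=
    fun a => within_iff_of_agree le_rfl fun a ha => (h a ha).1
  unfold rulingStep
  rw [(h v (Within.refl _ _ _)).2]
  refine propext (and_congr_right fun _ => imp_congr_right fun _ => not_congr ?_)
  refine exists_congr fun u => ?_
  rw [← hW u]
  refine and_congr_right fun hu => ?_
  rw [(h u hu).2]

lemma isLocal_ruling (k b : ℕ) : IsLocal (b * k) (ruling k b) := by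
  induction b with
  | zero => exact fun _ _ _ _ => rfl
  | succ b ih =>
    rw [Nat.succ_mul]
    exact (localRule_rulingStep k b).isLocal_self ih

/-- The vertices that have survived `b` steps and whose identifiers agree above the `b` lowest bits
are pairwise far apart. -/
lemma ruling_separated (k b : ℕ) (F : SimpleGraph ℕ) {u v : ℕ} (hu : ruling k b F u)
    (hv : ruling k b F v) (huv : u / 2 ^ b = v / 2 ^ b) (hne : u ≠ v) : ¬ Within F k u v := by
  induction b generalizing u v with
  | zero => simp at huv; exact absurd huv hne
  | succ b ih =>
    by_cases hbit : u / 2 ^ b = v / 2 ^ b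
    · exact ih hu.1 hv.1 hbit hne
    · have hmod : ∀ x : ℕ, x / 2 ^ b = 2 * (x / 2 ^ (b + 1)) + (x.testBit b).toNat := by
        intro x
        rw [Nat.toNat_testBit, pow_succ, ← Nat.div_div_eq_div_mul]
        omega
      intro hW
      cases hub : u.testBit b <;> cases hvb : v.testBit b
      · exact hbit (by rw [hmod u, hmod v, huv, hub, hvb])
      · exact hv.2 hvb ⟨u, hW.symm, hu.1, hub, huv⟩
      · exact hu.2 hub ⟨v, hW, hv.1, hvb, huv.symm⟩
      · exact hbit (by rw [hmod u, hmod v, huv, hub, hvb])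

lemma ruling_dominating (k b : ℕ) (F : SimpleGraph ℕ) (v : ℕ) :
    ∃ r, ruling k b F r ∧ Within F (b * k) v r := by
  induction b with
  | zero => exact ⟨v, trivial, Within.refl _ _ _⟩
  | succ b ih =>
    obtain ⟨r, hr, hvr⟩ := ih
    by_cases h : ruling k (b + 1) F r
    · exact ⟨r, h, hvr.mono (by nlinarith)⟩
    · have h' : ¬ (ruling k b F r ∧ _) := h
      push Not at h'
      obtain ⟨_, u, h1, h2, h3, h4⟩ := h' hr
      refine ⟨u, ⟨h2, fun h => by simp [h3] at h⟩, ?_⟩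
      rw [Nat.succ_mul]
      exact hvr.trans h1

/-- The distance from `v` to the set `R`, cut off at `M`. -/
noncomputable def distTo (M : ℕ) (F : SimpleGraph ℕ) (R : ℕ → Prop) (v : ℕ) : ℕ :=
  sInf {t | t ≤ M ∧ (t = M ∨ ∃ r, Within F t v r ∧ R r)}

lemma localRule_distTo (M : ℕ) : LocalRule M (distTo M) := by
  intro X X' l l' v h
  have hW : ∀ t ≤ M, ∀ a, Within X t v a ↔ Within X' t v a :=
    fun t ht a => within_iff_of_agree ht fun a ha => (h a ha).1
  unfold distTo
  congr 1
  ext t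
  refine and_congr_right fun ht => or_congr Iff.rfl (exists_congr fun r => ?_)
  rw [← hW t ht]
  refine and_congr_right fun hr => ?_
  rw [(h r (hr.mono ht)).2]

/-- From labels `d`, thought of as distances to a ruling set, select the vertices whose distance is
a multiple of `k + 1`, except those that are within distance `k` of another such vertex. -/
def sparsify (k : ℕ) (F : SimpleGraph ℕ) (d : ℕ → ℕ) (v : ℕ) : Prop :=
  k + 1 ∣ d v ∧ ¬ ∃ u, Within F k v u ∧ u ≠ v ∧ k + 1 ∣ d u

lemma localRule_sparsify (k : ℕ) : LocalRule k (sparsify k) := by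
  intro X X' l l' v h
  have hW : ∀ a, Within X k v a ↔ Within X' k v a :=
    fun a => within_iff_of_agree le_rfl fun a ha => (h a ha).1
  unfold sparsify
  rw [(h v (Within.refl _ _ _)).2]
  refine propext (and_congr_right fun _ => not_congr (exists_congr fun u => ?_))
  rw [← hW u]
  refine and_congr_right fun hu => ?_
  rw [(h u hu).2]

/-- A set of vertices that, in a graph of maximum degree two whose identifiers have `b` bits, is
`k`-separated and meets every ball of radius `3 (k + 1)`. -/
noncomputable def net (k b : ℕ) (F : SimpleGraph ℕ) : ℕ → Prop :=
  sparsify k F (distTo (b * k) F (ruling k b F))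

lemma isLocal_net (k b : ℕ) : IsLocal (b * k + b * k + k) (net k b) :=
  (localRule_sparsify k).isLocal_self
    ((localRule_distTo (b * k)).isLocal_self (isLocal_ruling k b))

lemma net_separated {k b : ℕ} {F : SimpleGraph ℕ} {u v : ℕ} (hu : net k b F u) (hv : net k b F v)
    (hne : u ≠ v) : ¬ Within F k u v :=
  fun h => hu.2 ⟨v, h, hne.symm, hv.1⟩

/-- On a shortest path from `v` to the ruling set the distances to the ruling set decrease by one in
each step, and a vertex in the middle of the path sees only the path. So such a vertex is selected
if its distance is a multiple of `k + 1`. -/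
lemma net_dominating {k b : ℕ} {F : SimpleGraph ℕ} (hF : ∀ v, DegLeTwo F v)
    (hb : ∀ v ∈ F.support, v < 2 ^ b) (v : ℕ) :
    ∃ s, net k b F s ∧ Within F (3 * (k + 1)) v s := by
  set R := ruling k b F with hR
  set d := distTo (b * k) F R with hd
  have hsep : ∀ u v, R u → R v → u ≠ v → ¬ Within F k u v := by
    intro u v hu hv hne hW
    have hsupp : ∀ {x y : ℕ}, x ≠ y → Within F k x y → x < 2 ^ b := by
      rintro x y hxy ⟨p, hp⟩
      cases p with
      | nil => exact absurd rfl hxy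
      | cons h q => exact hb x ⟨_, h⟩
    refine ruling_separated k b F hu hv ?_ hne hW
    rw [Nat.div_eq_of_lt (hsupp hne hW), Nat.div_eq_of_lt (hsupp hne.symm hW.symm)]
  have hmem : ∀ u, ∃ r, Within F (d u) u r ∧ R r := by
    intro u
    have hne : {t | t ≤ b * k ∧ (t = b * k ∨ ∃ r, Within F t u r ∧ R r)}.Nonempty :=
      ⟨b * k, le_rfl, .inl rfl⟩
    obtain ⟨_, h | h⟩ := Nat.sInf_mem hne
    · obtain ⟨r, hr, hur⟩ := ruling_dominating k b F u
      exact ⟨r, by rw [hd, distTo, h]; exact hur, hr⟩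
    · exact h
  have hle : ∀ u r t, R r → Within F t u r → d u ≤ t := by
    intro u r t hr h
    by_cases ht : t ≤ b * k
    · exact Nat.sInf_le ⟨ht, .inr ⟨r, h, hr⟩⟩
    · have : d u ≤ b * k := Nat.sInf_le ⟨le_rfl, .inl rfl⟩
      omega
  obtain ⟨r, hvr, hr⟩ := hmem v
  by_cases hsmall : d v ≤ 3 * (k + 1)
  · have h0 : d r = 0 := Nat.le_zero.1 (hle r r 0 hr (Within.refl _ _ _))
    refine ⟨r, ⟨by rw [← hR, ← hd, h0]; exact dvd_zero _, ?_⟩, hvr.mono hsmall⟩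
    rintro ⟨u, hu, hne, hdvd⟩
    rw [← hR, ← hd] at hdvd
    have hdu : d u ≤ k := hle u r k hr hu.symm
    have hdu0 : d u = 0 := Nat.eq_zero_of_dvd_of_lt hdvd (by omega)
    obtain ⟨r', hr', hRr'⟩ := hmem u
    rw [hdu0, within_zero] at hr'
    subst hr'
    exact hsep r u hr hRr' hne.symm hu
  · obtain ⟨p, L, hL, hp0, hpL, hadj, hinj, hmin⟩ := hvr.exists_geodesic
    obtain rfl : L = d v := le_antisymm hL (hle v r L hr (by
      have := within_of_seq hadj 0 L (by omega)
      rwa [hp0, Nat.zero_add, hpL] at this))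
    have hdp : ∀ j ≤ d v, d (p j) = d v - j := by
      intro j hj
      refine le_antisymm (hle _ r _ hr ?_) ?_
      · have := within_of_seq hadj j (d v - j) (by omega)
        rwa [Nat.add_sub_cancel' hj, hpL] at this
      · obtain ⟨r', h1, h2⟩ := hmem (p j)
        have h3 := within_of_seq hadj 0 j (by omega)
        rw [hp0, Nat.zero_add] at h3
        have := hle v r' _ h2 (h3.trans h1)
        omega
    have hmod : d v % (k + 1) < k + 1 := Nat.mod_lt _ (Nat.succ_pos k)
    have hdiv := Nat.div_add_mod (d v) (k + 1)
    -- the first vertex at distance at least `k + 1` from `v` whose label is a multiple of `k + 1`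
    set t := (k + 1) + d v % (k + 1) with ht
    have hdvd : k + 1 ∣ d v - t := by
      refine ⟨d v / (k + 1) - 1, ?_⟩
      rw [Nat.mul_sub, Nat.mul_one]
      omega
    refine ⟨p t, ⟨by rw [← hR, ← hd, hdp t (by omega)]; exact hdvd, ?_⟩, ?_⟩
    · rintro ⟨u, hu, hne, hu'⟩
      rw [← hR, ← hd] at hu'
      have hpath : ∀ i, 0 < i → i < d v → ∀ z, F.Adj (p i) z → z = p (i - 1) ∨ z = p (i + 1) := by
        intro i h0 h1 z hz
        refine hF (p i) _ _ _ ?_ (hadj i h1) hz ?_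
        · have := hadj (i - 1) (by omega)
          rw [Nat.sub_add_cancel h0] at this
          exact this.symm
        · intro h
          have := hinj _ _ (by omega) (by omega) h
          omega
      rcases within_path_or_escape hpath (i := t) (by omega) hu with
        ⟨j, h1, h2, h3, h4, rfl⟩ | ⟨s, h1, _⟩ | ⟨s, h1, _⟩
      · rw [hdp j h2.le] at hu'
        have hjt : j ≠ t := fun h => hne (by rw [h])
        rcases Nat.lt_or_ge j t with h | h
        · have := Nat.dvd_sub hu' hdvd
          have := Nat.le_of_dvd (by omega) this
          omega
        · have := Nat.dvd_sub hdvd hu'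
          have := Nat.le_of_dvd (by omega) this
          omega
      · omega
      · omega
    · have h3 := within_of_seq hadj 0 t (by omega)
      rw [hp0, Nat.zero_add] at h3
      exact h3.mono (by omega)

/-! ### Walks in the Kneser graph -/

/-- The colors of the vertices: the `q`-element subsets of a set with `2q + 1` elements. -/
abbrev Color (q : ℕ) := {s : Finset (Fin (2 * q + 1)) // s.card = q}

namespace Color

variable {q : ℕ}

/-- Two colors that adjacent vertices may have. -/
def Compat (A B : Color q) : Prop := Disjoint A.1 B.1

lemma Compat.symm {A B : Color q} (h : Compat A B) : Compat B A := Disjoint.symm h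

/-- `KWalk L A B w` says that `w 0, …, w L` is a walk from `A` to `B` in the Kneser graph. -/
def KWalk (L : ℕ) (A B : Color q) (w : ℕ → Color q) : Prop :=
  w 0 = A ∧ w L = B ∧ ∀ i < L, Compat (w i) (w (i + 1))

lemma exists_compat_insert (A : Color q) (b : Fin (2 * q + 1)) :
    ∃ D : Color q, Disjoint (insert b A.1) D.1 := by
  have hcard : q ≤ ((insert b A.1)ᶜ).card := by
    rw [Finset.card_compl, Fintype.card_fin]
    have := Finset.card_insert_le b A.1
    have := A.2
    omega
  obtain ⟨D, hD, hDc⟩ := Finset.exists_subset_card_eq hcard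
  exact ⟨⟨D, hDc⟩, Finset.disjoint_of_subset_right hD disjoint_compl_right⟩

lemma exists_compat (A : Color q) : ∃ D, Compat A D := by
  obtain ⟨D, hD⟩ := exists_compat_insert A 0
  exact ⟨D, Finset.disjoint_of_subset_left (Finset.subset_insert _ _) hD⟩

lemma KWalk.cons {L : ℕ} {A D B : Color q} {w : ℕ → Color q} (h : KWalk L D B w)
    (hA : Compat A D) : ∃ w', KWalk (L + 1) A B w' := by
  refine ⟨fun i => Nat.casesOn i A w, rfl, h.2.1, fun i hi => ?_⟩
  cases i with
  | zero => simpa [h.1] using hA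
  | succ i => exact h.2.2 i (by omega)

/-- Two steps of a walk can exchange one element, so a walk of length `2k` can exchange `k`. -/
lemma exists_kWalk_even (k : ℕ) (A B : Color q) (h : (A.1 \ B.1).card ≤ k) :
    ∃ w, KWalk (2 * k) A B w := by
  induction k generalizing A with
  | zero =>
    have hsub : A.1 ⊆ B.1 := by
      rw [← Finset.sdiff_eq_empty_iff_subset, ← Finset.card_eq_zero]; omega
    have hAB : A = B := Subtype.ext (Finset.eq_of_subset_of_card_le hsub (by rw [A.2, B.2]))
    exact ⟨fun _ => A, rfl, hAB, by simp⟩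
  | succ k ih =>
    suffices h' : ∃ D A' : Color q, Compat A D ∧ Compat D A' ∧ (A'.1 \ B.1).card ≤ k by
      obtain ⟨D, A', h1, h2, h3⟩ := h'
      obtain ⟨w, hw⟩ := ih A' h3
      obtain ⟨w', hw'⟩ := hw.cons h2
      exact hw'.cons h1
    by_cases h0 : (A.1 \ B.1).card = 0
    · obtain ⟨D, hD⟩ := exists_compat A
      exact ⟨D, A, hD, hD.symm, by omega⟩
    · obtain ⟨a, ha⟩ := Finset.card_pos.1 (Nat.pos_of_ne_zero h0)
      have hBA : (B.1 \ A.1).card = (A.1 \ B.1).card :=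
        (Finset.card_sdiff_comm (by rw [A.2, B.2])).symm
      obtain ⟨b, hb⟩ := Finset.card_pos.1 (hBA ▸ Nat.pos_of_ne_zero h0)
      rw [Finset.mem_sdiff] at ha hb
      obtain ⟨D, hD⟩ := exists_compat_insert A b
      have hbe : b ∉ A.1.erase a := fun h => hb.2 (Finset.mem_of_mem_erase h)
      refine ⟨D, ⟨insert b (A.1.erase a), ?_⟩, ?_, ?_, ?_⟩
      · have := Finset.card_pos.2 ⟨a, ha.1⟩
        have := A.2
        rw [Finset.card_insert_of_notMem hbe, Finset.card_erase_of_mem ha.1]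
        omega
      · exact Finset.disjoint_of_subset_left (Finset.subset_insert _ _) hD
      · exact (Finset.disjoint_of_subset_left
          (Finset.insert_subset_insert _ (Finset.erase_subset _ _)) hD).symm
      · have hsub : insert b (A.1.erase a) \ B.1 ⊆ (A.1 \ B.1).erase a := by
          intro x hx
          simp only [Finset.mem_sdiff, Finset.mem_insert, Finset.mem_erase] at hx ⊢
          rcases hx with ⟨rfl | hx, hxB⟩
          · exact absurd hb.1 hxB
          · exact ⟨hx.1, hx.2, hxB⟩
        have := Finset.card_le_card hsub
        rw [Finset.card_erase_of_mem (Finset.mem_sdiff.2 ha)] at this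
        exact this.trans (by omega)

/-- Any two colors are joined by walks of all lengths from `2q` on. -/
lemma exists_kWalk (L : ℕ) (hL : 2 * q ≤ L) (A B : Color q) : ∃ w, KWalk L A B w := by
  have hq : ∀ A : Color q, (A.1 \ B.1).card ≤ q := fun A =>
    (Finset.card_le_card Finset.sdiff_subset).trans A.2.le
  rcases Nat.even_or_odd' L with ⟨k, rfl | rfl⟩
  · exact exists_kWalk_even k A B ((hq A).trans (by omega))
  · obtain ⟨D, hD⟩ := exists_compat A
    obtain ⟨w, hw⟩ := exists_kWalk_even k D B ((hq D).trans (by omega))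
    exact hw.cons hD

end Color

open Color

/-! ### Extending a coloring along a path -/

/-- A sequence `p 0, …, p L` of consecutive neighbors that runs through `C`, with ends off `C`,
without repeating an inner vertex or turning back. -/
structure IsThread {V : Type*} (H : SimpleGraph V) (C : Set V) (p : ℕ → V) (L : ℕ) : Prop where
  two_le : 2 ≤ L
  adj : ∀ i < L, H.Adj (p i) (p (i + 1))
  mem : ∀ i, 0 < i → i < L → p i ∈ C
  left : p 0 ∉ C
  right : p L ∉ C
  inj : ∀ i j, 0 < i → i < L → 0 < j → j < L → p i = p j → i = j
  ne : L = 2 → p 0 ≠ p 2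

/-- The two neighbors of an inner vertex of a thread are its neighbors on the thread. -/
lemma IsThread.eq_or_eq {V : Type*} {H : SimpleGraph V} {C : Set V} {p : ℕ → V} {L : ℕ}
    (h : IsThread H C p L) {i : ℕ} (h0 : 0 < i) (h1 : i < L) (hd : DegLeTwo H (p i)) {z : V}
    (hz : H.Adj (p i) z) : z = p (i - 1) ∨ z = p (i + 1) := by
  have hprev := h.adj (i - 1) (by omega)
  rw [Nat.sub_add_cancel h0] at hprev
  refine hd _ _ _ hprev.symm (h.adj i h1) hz fun heq => ?_
  rcases Nat.lt_or_ge 1 i with h2 | h2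
  · rcases Nat.lt_or_ge (i + 1) L with h3 | h3
    · have := h.inj _ _ (by omega) (by omega) (by omega) h3 heq
      omega
    · obtain rfl : L = i + 1 := by omega
      exact h.right (heq ▸ h.mem (i - 1) (by omega) (by omega))
  · obtain rfl : i = 1 := by omega
    rcases Nat.lt_or_ge 2 L with h3 | h3
    · exact h.left (by rw [show p 0 = p 2 from heq]; exact h.mem 2 (by omega) h3)
    · exact h.ne (by omega) heq

/-- Let `C` be a finite connected set of vertices of degree at most two that has a neighbor off `C`.
If all threads through `C` have length at least `2q`, then every coloring of the other vertices
extends to `C`. Indeed `C` is a path, and it is colored by a walk in the Kneser graph. -/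
theorem exists_extension {V : Type*} {q : ℕ} {H : SimpleGraph V} {C : Set V} (hfin : C.Finite)
    (hdeg : ∀ v ∈ C, DegLeTwo H v)
    (hconn : ∀ Z ⊆ C, Z.Nonempty → (∀ a ∈ Z, ∀ b ∈ C, H.Adj a b → b ∈ Z) → Z = C)
    (hout : ∃ x ∉ C, ∃ v ∈ C, H.Adj x v)
    (hlong : ∀ p L, IsThread H C p L → 2 * q ≤ L) (f : V → Color q) :
    ∃ g : V → Color q, (∀ v ∉ C, g v = f v) ∧ ∀ a ∈ C, ∀ b, H.Adj a b → Compat (g a) (g b) := by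
  classical
  obtain ⟨x, hx, v₁, hv₁, hxv⟩ := hout
  -- `P m p`: the sequence `p` starts at `x` and continues for `m` steps as a path in `C`
  let P : ℕ → (ℕ → V) → Prop := fun m p => p 0 = x ∧ (∀ i < m, H.Adj (p i) (p (i + 1))) ∧
    (∀ i, 0 < i → i ≤ m → p i ∈ C) ∧
    ∀ i j, 0 < i → i ≤ m → 0 < j → j ≤ m → p i = p j → i = j
  have hP1 : ∃ p, P 1 p := by
    refine ⟨fun i => if i = 0 then x else v₁, by simp, ?_, ?_, ?_⟩
    · intro i hi
      obtain rfl : i = 0 := by omega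
      simpa using hxv
    · intro i h0 _
      simpa [Nat.pos_iff_ne_zero.1 h0] using hv₁
    · intros
      omega
  have hPbound : ∀ m p, P m p → m ≤ hfin.toFinset.card := by
    rintro m p ⟨-, -, h3, h4⟩
    calc m = (Finset.Icc 1 m).card := by simp
      _ = ((Finset.Icc 1 m).image p).card := by
          refine (Finset.card_image_of_injOn fun i hi j hj hij => ?_).symm
          simp only [Finset.coe_Icc, Set.mem_Icc] at hi hj
          exact h4 i j (by omega) hi.2 (by omega) hj.2 hij
      _ ≤ _ := by
          refine Finset.card_le_card fun y hy => ?_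
          obtain ⟨i, hi, rfl⟩ := Finset.mem_image.1 hy
          rw [Finset.mem_Icc] at hi
          simpa using h3 i (by omega) hi.2
  obtain ⟨m, hm, p, hp, hmax⟩ : ∃ m, 1 ≤ m ∧ ∃ p, P m p ∧ ∀ p', ¬ P (m + 1) p' := by
    by_contra! hcon
    have : ∀ m, 1 ≤ m → ∃ p, P m p := by
      intro m hm
      induction m, hm using Nat.le_induction with
      | base => exact hP1
      | succ m hm ih =>
        obtain ⟨p, hp⟩ := ih
        exact hcon m hm p hp
    obtain ⟨p, hp⟩ := this (hfin.toFinset.card + 1) (by omega)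
    have := hPbound _ _ hp
    omega
  obtain ⟨hp0, hadj, hmem, hinj⟩ := hp
  have hprev : ∀ i, 0 < i → i ≤ m → H.Adj (p i) (p (i - 1)) := by
    intro i h0 h1
    have := hadj (i - 1) (by omega)
    rw [Nat.sub_add_cancel h0] at this
    exact this.symm
  have hinner : ∀ i, 0 < i → i < m → ∀ z, H.Adj (p i) z → z = p (i - 1) ∨ z = p (i + 1) := by
    intro i h0 h1 z hz
    refine hdeg (p i) (hmem i h0 h1.le) _ _ _ (hprev i h0 h1.le) (hadj i h1) hz fun heq => ?_
    rcases Nat.lt_or_ge 1 i with h2 | h2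
    · have := hinj _ _ (by omega) (by omega) (by omega) (by omega) heq
      omega
    · obtain rfl : i = 1 := by omega
      simp only [Nat.sub_self] at heq
      exact hx (hp0 ▸ heq ▸ hmem 2 (by omega) h1)
  have hold : ∀ z i, i ≤ m → Function.update p (m + 1) z i = p i :=
    fun z i hi => Function.update_of_ne (by omega) _ _
  have hnew : ∀ z, Function.update p (m + 1) z (m + 1) = z := fun z => Function.update_self _ _ _
  have hadj' : ∀ z, H.Adj (p m) z → ∀ i < m + 1,
      H.Adj (Function.update p (m + 1) z i) (Function.update p (m + 1) z (i + 1)) := by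
    intro z hz i hi
    rcases Nat.lt_or_ge i m with h | h
    · rw [hold z i h.le, hold z (i + 1) h]
      exact hadj i h
    · obtain rfl : i = m := by omega
      rwa [hold z i le_rfl, hnew]
  -- a neighbor in `C` of the last vertex is on the path, because the path is maximal
  have hlast : ∀ z ∈ C, H.Adj (p m) z → ∃ i, 0 < i ∧ i ≤ m ∧ z = p i := by
    intro z hz hmz
    by_contra! hcon
    refine hmax (Function.update p (m + 1) z)
      ⟨by rw [hold z 0 (by omega), hp0], hadj' z hmz, ?_, ?_⟩
    · intro i h0 h1
      rcases h1.lt_or_eq with h | rfl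
      · rw [hold z i (by omega)]
        exact hmem i h0 (by omega)
      · rwa [hnew]
    · intro i j hi hi' hj hj' hij
      rcases hi'.lt_or_eq with h | rfl <;> rcases hj'.lt_or_eq with h' | rfl
      · rw [hold z i (by omega), hold z j (by omega)] at hij
        exact hinj i j hi (by omega) hj (by omega) hij
      · rw [hold z i (by omega), hnew] at hij
        exact absurd hij.symm (hcon i hi (by omega))
      · rw [hold z j (by omega), hnew] at hij
        exact absurd hij (hcon j hj (by omega))
      · rfl
  have hC : ∀ z ∈ C, ∃ i, 0 < i ∧ i ≤ m ∧ z = p i := by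
    have : {z | ∃ i, 0 < i ∧ i ≤ m ∧ z = p i} = C := by
      refine hconn _ ?_ ⟨p 1, 1, by omega, hm, rfl⟩ ?_
      · rintro z ⟨i, h0, h1, rfl⟩
        exact hmem i h0 h1
      · rintro _ ⟨i, h0, h1, rfl⟩ z hz hiz
        rcases h1.lt_or_eq with h1 | rfl
        · rcases hinner i h0 h1 z hiz with rfl | rfl
          · rcases Nat.lt_or_ge 1 i with h2 | h2
            · exact ⟨i - 1, by omega, by omega, rfl⟩
            · obtain rfl : i = 1 := by omega
              exact absurd (hp0 ▸ hz) hx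
          · exact ⟨i + 1, by omega, by omega, rfl⟩
        · exact hlast z hz hiz
    exact fun z hz => (Set.ext_iff.1 this z).2 hz
  -- it remains to find a walk that is right at the last vertex
  suffices hw : ∃ w : ℕ → Color q, w 0 = f x ∧ (∀ i < m, Compat (w i) (w (i + 1))) ∧
      ∀ z, z ∉ C → z ≠ p (m - 1) → H.Adj (p m) z → Compat (w m) (f z) by
    obtain ⟨w, hw0, hw1, hw2⟩ := hw
    let g : V → Color q := fun v =>
      if h : ∃ i, 0 < i ∧ i ≤ m ∧ v = p i then w h.choose else f v
    have hgp : ∀ i, i ≤ m → g (p i) = w i := by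
      intro i hi
      by_cases h : ∃ j, 0 < j ∧ j ≤ m ∧ p i = p j
      · have hs := h.choose_spec
        simp only [g, dif_pos h]
        rcases Nat.eq_zero_or_pos i with rfl | h0
        · exact absurd (hp0 ▸ hs.2.2 ▸ hmem _ hs.1 hs.2.1) hx
        · rw [← hinj _ _ h0 hi hs.1 hs.2.1 hs.2.2]
      · simp only [g, dif_neg h]
        rcases Nat.eq_zero_or_pos i with rfl | h0
        · rw [hp0, hw0]
        · exact absurd ⟨i, h0, hi, rfl⟩ h
    have hgf : ∀ v ∉ C, g v = f v := by
      intro v hv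
      refine dif_neg ?_
      rintro ⟨i, h0, h1, rfl⟩
      exact hv (hmem i h0 h1)
    have hstep : ∀ i < m, Compat (g (p i)) (g (p (i + 1))) := by
      intro i hi
      rw [hgp i hi.le, hgp (i + 1) hi]
      exact hw1 i hi
    refine ⟨g, hgf, fun a ha b hab => ?_⟩
    obtain ⟨i, h0, h1, rfl⟩ := hC a ha
    have hback : Compat (g (p i)) (g (p (i - 1))) := by
      have := hstep (i - 1) (by omega)
      rw [Nat.sub_add_cancel h0] at this
      exact this.symm
    rcases h1.lt_or_eq with h1 | rfl
    · rcases hinner i h0 h1 b hab with rfl | rfl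
      · exact hback
      · exact hstep i h1
    · by_cases hb : b = p (i - 1)
      · rw [hb]
        exact hback
      · by_cases hbC : b ∈ C
        · obtain ⟨j, hj0, hj1, rfl⟩ := hC b hbC
          have hji : j < i := by
            rcases hj1.lt_or_eq with h | rfl
            · exact h
            · exact absurd hab (H.irrefl)
          rcases hinner j hj0 hji _ hab.symm with h | h
          · rcases Nat.lt_or_ge 1 j with h2 | h2
            · have := hinj _ _ h0 le_rfl (by omega) (by omega) h
              omega
            · obtain rfl : j = 1 := by omega
              simp only [Nat.sub_self] at h
              exact absurd (hp0 ▸ h ▸ hmem i h0 le_rfl) hx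
          · have := hinj _ _ h0 le_rfl (by omega) (by omega) h
            exact absurd (by rw [this]; rfl) hb
        · rw [hgf b hbC, hgp i le_rfl]
          exact hw2 b hbC hb hab
  by_cases hy : ∃ y, y ∉ C ∧ y ≠ p (m - 1) ∧ H.Adj (p m) y
  · obtain ⟨y, hyC, hyne, hmy⟩ := hy
    have hthread : IsThread H C (Function.update p (m + 1) y) (m + 1) := by
      refine ⟨by omega, hadj' y hmy, ?_, ?_, by rwa [hnew], ?_, ?_⟩
      · intro i h0 h1
        rw [hold y i (by omega)]
        exact hmem i h0 (by omega)
      · rwa [hold y 0 (by omega), hp0]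
      · intro i j hi hi' hj hj' hij
        rw [hold y i (by omega), hold y j (by omega)] at hij
        exact hinj i j hi (by omega) hj (by omega) hij
      · intro h
        obtain rfl : m = 1 := by omega
        rw [hold y 0 (by omega), hnew]
        exact hyne.symm
    have hL := hlong _ _ hthread
    obtain ⟨w, hw0, hwL, hw1⟩ := exists_kWalk (m + 1) hL (f x) (f y)
    refine ⟨w, hw0, fun i hi => hw1 i (by omega), fun z _ hz hmz => ?_⟩
    rcases hdeg (p m) (hmem m hm le_rfl) _ _ _ (hprev m hm le_rfl) hmy hmz hyne.symm with h | rfl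
    · exact absurd h hz
    · rw [← hwL]
      exact hw1 m (by omega)
  · obtain ⟨w, hw0, -, hw1⟩ := exists_kWalk (q := q) (m + 2 * q) (by omega) (f x) (f x)
    exact ⟨w, hw0, fun i hi => hw1 i (by omega), fun z h1 h2 h3 => absurd ⟨z, h1, h2, h3⟩ hy⟩

/-! ### Deleting edges -/

/-- The edges of `H` with both ends in `P`. -/
def keep (H : SimpleGraph ℕ) (P : ℕ → Prop) : SimpleGraph ℕ where
  Adj a b := H.Adj a b ∧ P a ∧ P b
  symm := ⟨fun _ _ h => ⟨h.1.symm, h.2.2, h.2.1⟩⟩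
  loopless := ⟨fun _ h => H.irrefl h.1⟩

lemma keep_le (H : SimpleGraph ℕ) (P : ℕ → Prop) : keep H P ≤ H := fun _ _ h => h.1

lemma keep_mono (H : SimpleGraph ℕ) {P Q : ℕ → Prop} (h : ∀ v, P v → Q v) :
    keep H P ≤ keep H Q :=
  fun _ _ hab => ⟨hab.1, h _ hab.2.1, h _ hab.2.2⟩

lemma keep_neighborSet_congr {X X' : SimpleGraph ℕ} {P P' : ℕ → Prop} {v : ℕ}
    (h : X.neighborSet v = X'.neighborSet v) (hv : P v = P' v)
    (hP : ∀ w, X.Adj v w → P w = P' w) :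
    (keep X P).neighborSet v = (keep X' P').neighborSet v := by
  ext w
  have hvw : X.Adj v w ↔ X'.Adj v w := Set.ext_iff.1 h w
  change X.Adj v w ∧ P v ∧ P w ↔ X'.Adj v w ∧ P' v ∧ P' w
  rw [← hvw, hv]
  exact and_congr_right fun hw => by rw [hP w hw]

lemma isLocalOp_keep {r : ℕ} {P : SimpleGraph ℕ → ℕ → Prop} (hP : IsLocal r P) :
    IsLocalOp (r + 1) fun H => keep H (P H) := by
  refine ⟨fun H => keep_le H _, fun H H' v h => ?_⟩
  refine keep_neighborSet_congr (h v (Within.refl _ _ _))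
    (hP H H' v fun a ha => h a (ha.mono (by omega))) fun w hw => ?_
  exact hP H H' w fun a ha => h a (((within_of_adj hw).trans ha).mono (by omega))

lemma Within.mem_of_keep {H : SimpleGraph ℕ} {P : ℕ → Prop} {r u v : ℕ}
    (h : Within (keep H P) r u v) (hu : P u) : P v :=
  h.mem_of_closed (Z := {x | P x}) hu fun _ _ _ hab => hab.2.2

/-- The degree of a vertex. A vertex with infinitely many neighbors gets the value `0`; the graphs
that come from networks have none. -/
noncomputable def deg (H : SimpleGraph ℕ) (v : ℕ) : ℕ := (H.neighborSet v).ncard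

lemma isLocal_deg : IsLocal 0 deg := fun _ _ v h => by
  rw [deg, deg, h v (Within.refl _ _ _)]

lemma finite_neighborSet {H : SimpleGraph ℕ} (hfin : H.support.Finite) (v : ℕ) :
    (H.neighborSet v).Finite :=
  hfin.subset fun _ hw => ⟨v, SimpleGraph.Adj.symm hw⟩

lemma support_mono_finite {H H' : SimpleGraph ℕ} (hfin : H.support.Finite) (h : H' ≤ H) :
    H'.support.Finite :=
  hfin.subset (SimpleGraph.support_mono h)

lemma degLeTwo_of_deg_le {H : SimpleGraph ℕ} (hfin : H.support.Finite) {v : ℕ}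
    (h : deg H v ≤ 2) : DegLeTwo H v := by
  intro a b c ha hb hc hab
  by_contra! hcon
  have hsub : (({a, b, c} : Finset ℕ) : Set ℕ) ⊆ H.neighborSet v := by
    intro x hx
    simp only [Finset.coe_insert, Finset.coe_singleton, Set.mem_insert_iff,
      Set.mem_singleton_iff] at hx
    rcases hx with rfl | rfl | rfl <;> assumption
  have := Set.ncard_le_ncard hsub (finite_neighborSet hfin v)
  rw [Set.ncard_coe_finset, Finset.card_eq_three.2 ⟨a, b, c, hab, hcon.1.symm, hcon.2.symm, rfl⟩]
    at this
  exact absurd (this.trans h) (by omega)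

/-- Whether a label holds somewhere within distance `r`. -/
def nearby (r : ℕ) (X : SimpleGraph ℕ) (l : ℕ → Prop) (v : ℕ) : Prop :=
  ∃ w, Within X r v w ∧ l w

lemma localRule_nearby (r : ℕ) : LocalRule r (nearby r) := by
  intro X X' l l' v h
  refine propext (exists_congr fun w => ?_)
  rw [← within_iff_of_agree le_rfl fun a ha => (h a ha).1]
  exact and_congr_right fun hw => by rw [(h w hw).2]

/-- Delete the edges at the vertices of degree at most one. -/
noncomputable def rake (H : SimpleGraph ℕ) : SimpleGraph ℕ := keep H fun v => 2 ≤ deg H v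

lemma isLocalOp_rake : IsLocalOp 1 rake :=
  isLocalOp_keep (isLocal_deg.map fun d => 2 ≤ d)

/-- The vertices that have no vertex of degree at least three within distance `K`. -/
def deep (K : ℕ) (H : SimpleGraph ℕ) (v : ℕ) : Prop := ¬ nearby K H (fun w => 2 < deg H w) v

/-- The vertices within distance `K` of a deep vertex. The subgraph induced by the vertices of
degree at most two consists of paths and cycles, and those that contain a deep vertex form the
core. -/
def core (K : ℕ) (H : SimpleGraph ℕ) : ℕ → Prop := nearby K H (deep K H)

/-- Delete the edges at the vertices of the core. -/
def compress (K : ℕ) (H : SimpleGraph ℕ) : SimpleGraph ℕ := keep H fun v => ¬ core K H v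

lemma isLocal_deep (K : ℕ) : IsLocal K (deep K) :=
  (((localRule_nearby K).isLocal_self (isLocal_deg.map fun d => 2 < d)).map Not).mono (by omega)

lemma isLocal_core (K : ℕ) : IsLocal (K + K) (core K) :=
  (localRule_nearby K).isLocal_self (isLocal_deep K)

lemma isLocalOp_compress (K : ℕ) : IsLocalOp (K + K + 1) (compress K) :=
  isLocalOp_keep ((isLocal_core K).map Not)

lemma deep.deg_le {K : ℕ} {H : SimpleGraph ℕ} {v w : ℕ} (h : deep K H v) (hw : Within H K v w) :
    deg H w ≤ 2 := by
  by_contra hcon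
  exact h ⟨w, hw, by omega⟩

lemma deep.core_of_within {K : ℕ} {H : SimpleGraph ℕ} {v w : ℕ} (h : deep K H v)
    (hw : Within H K v w) : core K H w :=
  ⟨v, hw.symm, h⟩

lemma core.deg_le {K : ℕ} {H : SimpleGraph ℕ} {v : ℕ} (h : core K H v) : deg H v ≤ 2 := by
  obtain ⟨w, hw, hd⟩ := h
  exact hd.deg_le hw.symm

/-- `f` is a proper coloring of `H` in the sense of fractional colorings. -/
def Proper {q : ℕ} (H : SimpleGraph ℕ) (f : ℕ → Color q) : Prop :=
  ∀ a b, H.Adj a b → Compat (f a) (f b)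

/-! ### Recoloring vertices of degree one -/

/-- The neighbors whose color a vertex `v` of degree at most one has to avoid: if two such vertices
are adjacent, then only the one with the larger identifier changes its color. -/
def Dominates (X : SimpleGraph ℕ) (v w : ℕ) : Prop := X.Adj v w ∧ (2 ≤ deg X w ∨ w < v)

open Classical in
/-- Give the vertices of degree at most one a color that fits the color of their neighbor. -/
noncomputable def rakeColor {q : ℕ} (X : SimpleGraph ℕ) (l : ℕ → Color q) (v : ℕ) : Color q :=
  if deg X v ≤ 1 ∧ ∃ w, Dominates X v w then
    @Classical.epsilon _ ⟨l v⟩ fun D => ∀ w, Dominates X v w → Compat D (l w)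
  else l v

open Classical in
lemma localRule_rakeColor (q : ℕ) : LocalRule 1 (rakeColor (q := q)) := by
  intro X X' l l' v h
  have hv := h v (Within.refl _ _ _)
  have hdeg : ∀ w, Within X 1 v w → deg X w = deg X' w := fun w hw => by
    rw [deg, deg, (h w hw).1]
  have hdom : ∀ w, Dominates X v w ↔ Dominates X' v w := by
    intro w
    have hvw : X.Adj v w ↔ X'.Adj v w := Set.ext_iff.1 hv.1 w
    unfold Dominates
    rw [← hvw]
    exact and_congr_right fun hw => by rw [hdeg w (within_of_adj hw)]
  have hcol : (fun D : Color q => ∀ w, Dominates X v w → Compat D (l w)) =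
      fun D => ∀ w, Dominates X' v w → Compat D (l' w) := by
    funext D
    refine propext (forall_congr' fun w => ?_)
    rw [← hdom w]
    exact imp_congr_right fun hw => by rw [(h w (within_of_adj hw.1)).2]
  have hex : (deg X v ≤ 1 ∧ ∃ w, Dominates X v w) ↔ (deg X' v ≤ 1 ∧ ∃ w, Dominates X' v w) := by
    rw [hdeg v (Within.refl _ _ _)]
    exact and_congr_right fun _ => exists_congr hdom
  unfold rakeColor
  rw [hcol, hv.2]
  exact if_congr hex rfl rfl

lemma eq_of_deg_le_one {H : SimpleGraph ℕ} (hfin : H.support.Finite) {v a b : ℕ}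
    (h : deg H v ≤ 1) (ha : H.Adj v a) (hb : H.Adj v b) : a = b :=
  (Set.ncard_le_one (finite_neighborSet hfin v)).1 h a ha b hb

lemma proper_rakeColor {q : ℕ} {H : SimpleGraph ℕ} (hfin : H.support.Finite) {f : ℕ → Color q}
    (hf : Proper (rake H) f) : Proper H (rakeColor H f) := by
  have hnew : ∀ v w, deg H v ≤ 1 → Dominates H v w → Compat (rakeColor H f v) (f w) := by
    intro v w hv hw
    rw [rakeColor, if_pos ⟨hv, w, hw⟩]
    refine @Classical.epsilon_spec _
      (fun D : Color q => ∀ w, Dominates H v w → Compat D (f w)) ?_ w hw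
    obtain ⟨D, hD⟩ := exists_compat (f w)
    refine ⟨D, fun w' hw' => ?_⟩
    rw [eq_of_deg_le_one hfin hv hw'.1 hw.1]
    exact hD.symm
  have hold : ∀ v, (∀ w, deg H v ≤ 1 → ¬ Dominates H v w) → rakeColor H f v = f v := by
    intro v hv
    refine if_neg ?_
    rintro ⟨h1, w, hw⟩
    exact hv w h1 hw
  have hbig : ∀ v, 2 ≤ deg H v → rakeColor H f v = f v :=
    fun v hv => hold v fun w h => absurd hv (by omega)
  have hone : ∀ a b, H.Adj a b → deg H a ≤ 1 → (2 ≤ deg H b ∨ b < a) →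
      Compat (rakeColor H f a) (rakeColor H f b) := by
    intro a b hab ha hb
    have hfb : rakeColor H f b = f b := by
      refine hold b fun w hb1 hw => ?_
      rw [eq_of_deg_le_one hfin hb1 hw.1 hab.symm] at hw
      rcases hw.2 with h | h
      · omega
      · omega
    rw [hfb]
    exact hnew a b ha ⟨hab, hb⟩
  intro a b hab
  rcases Nat.lt_or_ge (deg H a) 2 with ha | ha <;> rcases Nat.lt_or_ge (deg H b) 2 with hb | hb
  · rcases Nat.lt_or_ge b a with h | h
    · exact hone a b hab (by omega) (.inr h)
    · have hne := hab.ne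
      exact (hone b a hab.symm (by omega) (.inr (by omega))).symm
  · exact hone a b hab (by omega) (.inl hb)
  · exact (hone b a hab.symm (by omega) (.inl ha)).symm
  · rw [hbig a ha, hbig b hb]
    exact hf a b ⟨hab, ha, hb⟩

/-! ### Recoloring clusters -/

instance (q : ℕ) : Nonempty (Color q) := by
  obtain ⟨D, -, hD⟩ := Finset.exists_subset_card_eq
    (s := (Finset.univ : Finset (Fin (2 * q + 1)))) (n := q) (by simp; omega)
  exact ⟨⟨D, hD⟩⟩

/-- An arbitrary color. -/
noncomputable def baseColor (q : ℕ) : Color q := Classical.arbitrary _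

/-- The vertices that `v` reaches by at most `D` steps inside `W`. -/
def cluster (D : ℕ) (X : SimpleGraph ℕ) (W : ℕ → Prop) (v : ℕ) : Set ℕ :=
  {w | Within (keep X W) D v w}

/-- The edges of `X` that meet `C`. -/
def touching (X : SimpleGraph ℕ) (C : Set ℕ) : SimpleGraph ℕ where
  Adj a b := X.Adj a b ∧ (a ∈ C ∨ b ∈ C)
  symm := ⟨fun _ _ h => ⟨h.1.symm, h.2.symm⟩⟩
  loopless := ⟨fun _ h => X.irrefl h.1⟩

open Classical in
/-- The coloring `f` on `C` and the neighbors of `C`, and the base color elsewhere. -/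
noncomputable def maskColor {q : ℕ} (X : SimpleGraph ℕ) (C : Set ℕ) (f : ℕ → Color q) (a : ℕ) :
    Color q :=
  if a ∈ C ∨ ∃ c ∈ C, X.Adj c a then f a else baseColor q

open Classical in
/-- Some recoloring of `C` that is proper on the edges of `T` at `C`, if there is one. -/
noncomputable def solution {q : ℕ} (T : SimpleGraph ℕ) (C : Set ℕ) (f : ℕ → Color q) :
    ℕ → Color q :=
  if h : ∃ g : ℕ → Color q, (∀ v ∉ C, g v = f v) ∧ ∀ a ∈ C, ∀ b, T.Adj a b → Compat (g a) (g b)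
  then h.choose else f

open Classical in
/-- Recolor the vertices whose first label holds, cluster by cluster. All vertices of a cluster
choose the same recoloring, as it is a function of data on which they agree. -/
noncomputable def recolor {q : ℕ} (D : ℕ) (X : SimpleGraph ℕ) (l : ℕ → Prop × Color q) (v : ℕ) :
    Color q :=
  let C := cluster D X (fun a => (l a).1) v
  if (l v).1 then solution (touching X C) C (maskColor X C fun a => (l a).2) v else (l v).2

lemma localRule_recolor (q D : ℕ) : LocalRule (D + 1) (recolor (q := q) D) := by
  intro X X' l l' v h
  have hkeep : ∀ a, Within X D v a → (keep X fun a => (l a).1).neighborSet a =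
      (keep X' fun a => (l' a).1).neighborSet a := by
    intro a ha
    have h1 := h a (ha.mono (Nat.le_succ D))
    refine keep_neighborSet_congr h1.1 (congrArg Prod.fst h1.2) fun w hw => ?_
    exact congrArg Prod.fst (h w (ha.trans (within_of_adj hw))).2
  have hC : cluster D X (fun a => (l a).1) v = cluster D X' (fun a => (l' a).1) v :=
    Set.ext fun w => within_iff_of_agree le_rfl fun a ha => hkeep a (ha.mono_graph (keep_le _ _))
  have hball : ∀ a ∈ cluster D X (fun a => (l a).1) v, Within X D v a :=
    fun a ha => Within.mono_graph ha (keep_le _ _)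
  unfold recolor
  rw [← hC, (h v (Within.refl _ _ _)).2]
  generalize cluster D X (fun a => (l a).1) v = C at hball ⊢
  have hadj : ∀ a ∈ C, ∀ b, X.Adj a b ↔ X'.Adj a b := fun a ha b =>
    Set.ext_iff.1 (h a ((hball a ha).mono (Nat.le_succ D))).1 b
  have hT : touching X C = touching X' C := by
    ext a b
    change X.Adj a b ∧ _ ↔ X'.Adj a b ∧ _
    refine and_congr_left ?_
    rintro (ha | hb)
    · exact hadj a ha b
    · rw [X.adj_comm, X'.adj_comm]
      exact hadj b hb a
  have hmask : (maskColor X C fun a => (l a).2) = maskColor X' C fun a => (l' a).2 := by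
    funext a
    unfold maskColor
    have hiff : (a ∈ C ∨ ∃ c ∈ C, X.Adj c a) ↔ (a ∈ C ∨ ∃ c ∈ C, X'.Adj c a) :=
      or_congr Iff.rfl (exists_congr fun c => and_congr_right fun hc => hadj c hc a)
    by_cases ha : a ∈ C ∨ ∃ c ∈ C, X.Adj c a
    · rw [if_pos ha, if_pos (hiff.1 ha)]
      rcases ha with ha | ⟨c, hc, hca⟩
      · exact congrArg Prod.snd (h a ((hball a ha).mono (Nat.le_succ D))).2
      · exact congrArg Prod.snd (h a ((hball c hc).trans (within_of_adj hca))).2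
    · rw [if_neg ha, if_neg (fun h => ha (hiff.2 h))]
  simp only [hT, hmask]

/-- Recoloring works if the clusters are the connected components of the set of recolored vertices
and every cluster can be recolored. -/
lemma proper_recolor {q D : ℕ} {H : SimpleGraph ℕ} {W : ℕ → Prop} {f : ℕ → Color q}
    (hcl : ∀ a b r, W a → Within (keep H W) r a b → Within (keep H W) D a b)
    (hext : ∀ v, W v → ∀ f : ℕ → Color q, ∃ g : ℕ → Color q, (∀ a ∉ cluster D H W v, g a = f a) ∧
      ∀ a ∈ cluster D H W v, ∀ b, H.Adj a b → Compat (g a) (g b))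
    (hf : ∀ a b, H.Adj a b → ¬ W a → ¬ W b → Compat (f a) (f b)) :
    Proper H (recolor D H fun a => (W a, f a)) := by
  have hself : ∀ v, v ∈ cluster D H W v := fun v => Within.refl _ _ _
  have hsol : ∀ v, W v → ∀ T h, T = touching H (cluster D H W v) →
      h = maskColor H (cluster D H W v) f →
      (∀ a ∉ cluster D H W v, solution T (cluster D H W v) h a = h a) ∧
      ∀ a ∈ cluster D H W v, ∀ b, T.Adj a b →
        Compat (solution T (cluster D H W v) h a) (solution T (cluster D H W v) h b) := by
    rintro v hv T h rfl rfl
    obtain ⟨g, hg1, hg2⟩ := hext v hv (maskColor H (cluster D H W v) f)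
    have hex : ∃ g : ℕ → Color q,
        (∀ a ∉ cluster D H W v, g a = maskColor H (cluster D H W v) f a) ∧
        ∀ a ∈ cluster D H W v, ∀ b, (touching H (cluster D H W v)).Adj a b →
          Compat (g a) (g b) :=
      ⟨g, hg1, fun a ha b hab => hg2 a ha b hab.1⟩
    rw [solution, dif_pos hex]
    exact hex.choose_spec
  have hW : ∀ v, W v → recolor D H (fun a => (W a, f a)) v =
      solution (touching H (cluster D H W v)) (cluster D H W v)
        (maskColor H (cluster D H W v) f) v := fun v hv => if_pos hv
  have hnW : ∀ v, ¬ W v → recolor D H (fun a => (W a, f a)) v = f v := fun v hv => if_neg hv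
  have key : ∀ a b, H.Adj a b → W a → Compat (recolor D H (fun a => (W a, f a)) a)
      (recolor D H (fun a => (W a, f a)) b) := by
    intro a b hab ha
    obtain ⟨h1, h2⟩ := hsol a ha _ _ rfl rfl
    have h3 := h2 a (hself a) b ⟨hab, .inl (hself a)⟩
    by_cases hb : W b
    · have hCC : cluster D H W b = cluster D H W a := by
        have hk : Within (keep H W) 1 a b := within_of_adj ⟨hab, ha, hb⟩
        ext c
        exact ⟨fun hc => hcl _ _ _ ha (hk.trans hc), fun hc => hcl _ _ _ hb (hk.symm.trans hc)⟩
      rw [hW a ha, hW b hb, hCC]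
      exact h3
    · have hbC : b ∉ cluster D H W a := fun hbC => hb (Within.mem_of_keep hbC ha)
      rw [hW a ha, hnW b hb]
      rw [h1 b hbC, maskColor, if_pos (.inr ⟨a, hself a, hab⟩)] at h3
      exact h3
  intro a b hab
  by_cases ha : W a
  · exact key a b hab ha
  · by_cases hb : W b
    · exact (key b a hab.symm hb).symm
    · rw [hnW a ha, hnW b hb]
      exact hf a b hab ha hb

/-! ### Recoloring the core -/

/-- A sequence of distinct consecutive neighbors is a path; its vertices and edges are known. -/
lemma exists_isPath_of_seq {V : Type*} {H : SimpleGraph V} {p : ℕ → V} (i n : ℕ)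
    (hadj : ∀ j, i ≤ j → j < i + n → H.Adj (p j) (p (j + 1)))
    (hinj : ∀ j k, i ≤ j → j ≤ i + n → i ≤ k → k ≤ i + n → p j = p k → j = k) :
    ∃ w : H.Walk (p i) (p (i + n)), w.IsPath ∧ w.length = n ∧
      (∀ x ∈ w.support, ∃ j, i ≤ j ∧ j ≤ i + n ∧ x = p j) ∧
      ∀ e ∈ w.edges, ∃ j, i ≤ j ∧ j < i + n ∧ e = s(p j, p (j + 1)) := by
  induction n generalizing i with
  | zero => exact ⟨.nil, by simp, rfl, fun x hx => ⟨i, le_rfl, le_rfl, by simpa using hx⟩, by simp⟩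
  | succ n ih =>
    obtain ⟨w, hw, hl, hs, he⟩ := ih (i + 1) (fun j h1 h2 => hadj j (by omega) (by omega))
      (fun j k h1 h2 h3 h4 => hinj j k (by omega) (by omega) (by omega) (by omega))
    have hi : i + 1 + n = i + (n + 1) := by omega
    rw [← hi]
    refine ⟨.cons (hadj i le_rfl (by omega)) w, ?_, by simp [hl], ?_, ?_⟩
    · rw [SimpleGraph.Walk.cons_isPath_iff]
      refine ⟨hw, fun hmem => ?_⟩
      obtain ⟨j, h1, h2, h3⟩ := hs _ hmem
      have := hinj i j le_rfl (by omega) (by omega) (by omega) h3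
      omega
    · intro x hx
      rw [SimpleGraph.Walk.support_cons, List.mem_cons] at hx
      rcases hx with rfl | hx
      · exact ⟨i, le_rfl, by omega, rfl⟩
      · obtain ⟨j, h1, h2, h3⟩ := hs x hx
        exact ⟨j, by omega, h2, h3⟩
    · intro e he'
      rw [SimpleGraph.Walk.edges_cons, List.mem_cons] at he'
      rcases he' with rfl | he'
      · exact ⟨i, le_rfl, by omega, rfl⟩
      · obtain ⟨j, h1, h2, h3⟩ := he e he'
        exact ⟨j, by omega, h2, h3⟩

/-- A closed thread is a cycle. -/
lemma IsThread.egirth_le {V : Type*} {H : SimpleGraph V} {C : Set V} {p : ℕ → V} {L : ℕ}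
    (h : IsThread H C p L) (hp : p 0 = p L) : H.egirth ≤ L := by
  have hL : 3 ≤ L := by
    by_contra hcon
    obtain rfl : L = 2 := by have := h.two_le; omega
    exact h.ne rfl hp
  have hinj : ∀ j k, 1 ≤ j → j ≤ L → 1 ≤ k → k ≤ L → p j = p k → j = k := by
    intro j k h1 h2 h3 h4 hjk
    rcases h2.lt_or_eq with h2 | rfl <;> rcases h4.lt_or_eq with h4 | rfl
    · exact h.inj j k h1 h2 h3 h4 hjk
    · exact absurd (hjk ▸ h.mem j h1 h2) h.right
    · exact absurd (hjk ▸ h.mem k h3 h4) h.right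
    · rfl
  have hL1 : 1 + (L - 1) = L := by omega
  obtain ⟨w, hw, hl, -, he⟩ := exists_isPath_of_seq (H := H) (p := p) 1 (L - 1)
    (fun j _ h2 => h.adj j (by omega))
    (fun j k h1 h2 h3 h4 => hinj j k h1 (by omega) h3 (by omega))
  have hadj : H.Adj (p (1 + (L - 1))) (p 1) := by
    rw [hL1, ← hp]
    exact h.adj 0 (by omega)
  have hcyc : (SimpleGraph.Walk.cons hadj w).IsCycle := by
    rw [SimpleGraph.Walk.cons_isCycle_iff]
    refine ⟨hw, fun hmem => ?_⟩
    obtain ⟨j, h1, h2, h3⟩ := he _ hmem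
    rw [hL1, Sym2.eq_iff] at h3
    rcases h3 with ⟨h3, h4⟩ | ⟨h3, h4⟩
    · have := hinj L j (by omega) le_rfl h1 (by omega) h3
      omega
    · have := hinj L (j + 1) (by omega) le_rfl (by omega) (by omega) h3
      have := hinj 1 j le_rfl (by omega) h1 (by omega) h4
      omega
  refine (SimpleGraph.egirth_le_length hcyc).trans ?_
  rw [SimpleGraph.Walk.length_cons, hl]
  exact_mod_cast (by omega : L - 1 + 1 ≤ L)

/-- The deep vertices at which the paths of the core are cut into pieces: a net of the graph that
is induced by the deep vertices. -/
def cut (q b : ℕ) (H : SimpleGraph ℕ) (v : ℕ) : Prop :=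
  deep (2 * q) H v ∧ net (2 * q - 1) b (keep H (deep (2 * q) H)) v

/-- The vertices that are recolored cluster by cluster. -/
def inner (q b : ℕ) (H : SimpleGraph ℕ) (v : ℕ) : Prop :=
  core (2 * q) H v ∧ ¬ cut q b H v

lemma isLocal_cut {q : ℕ} (hq : 1 ≤ q) (b : ℕ) : IsLocal ((4 * b + 4) * q) (cut q b) := by
  have h1 : IsLocal _ (deep (2 * q)) := isLocal_deep (2 * q)
  have h2 := (isLocal_net (2 * q - 1) b).comp (isLocalOp_keep h1)
  have hb : b * (2 * q - 1) ≤ b * (2 * q) := Nat.mul_le_mul_left b (by omega)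
  have he : (4 * b + 4) * q = b * (2 * q) + b * (2 * q) + 4 * q := by ring
  exact ((h1.mono (by omega)).prodMk (h2.mono (by omega))).map fun x => x.1 ∧ x.2

lemma isLocal_inner {q : ℕ} (hq : 1 ≤ q) (b : ℕ) : IsLocal ((4 * b + 4) * q) (inner q b) := by
  have he : (4 * b + 4) * q = b * q * 4 + 4 * q := by ring
  exact (((isLocal_core (2 * q)).mono (by omega)).prodMk (isLocal_cut hq b)).map
    fun x => x.1 ∧ ¬ x.2

section Core

variable {q b : ℕ} {H : SimpleGraph ℕ}

/-- Every core vertex is within distance `8q` of a cut vertex, inside the core. -/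
lemma exists_cut_within (hq : 1 ≤ q) (hfin : H.support.Finite) (hb : ∀ v ∈ H.support, v < 2 ^ b)
    {v : ℕ} (hv : core (2 * q) H v) :
    ∃ s, cut q b H s ∧ Within (keep H (core (2 * q) H)) (8 * q) v s := by
  obtain ⟨w, hvw, hw⟩ := hv
  have hdc : ∀ x, deep (2 * q) H x → core (2 * q) H x :=
    fun x hx => hx.core_of_within (Within.refl _ _ _)
  have h1 : Within (keep H (core (2 * q) H)) (2 * q) w v :=
    hvw.symm.transfer fun a c ha hc hac => ⟨hac, hw.core_of_within ha, hw.core_of_within hc⟩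
  have hF : ∀ x, DegLeTwo (keep H (deep (2 * q) H)) x := by
    intro x
    by_cases hx : deep (2 * q) H x
    · exact (degLeTwo_of_deg_le hfin (hx.deg_le (Within.refl _ _ _))).mono (keep_le _ _)
    · exact fun a _ _ ha => absurd ha.2.1 hx
  obtain ⟨s, hs, hws⟩ := net_dominating (k := 2 * q - 1) (b := b) hF
    (fun x hx => hb x (SimpleGraph.support_mono (keep_le _ _) hx)) w
  refine ⟨s, ⟨hws.mem_of_keep hw, hs⟩, ?_⟩
  exact (h1.symm.trans (hws.mono_graph (keep_mono H hdc))).mono (by omega)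

lemma cut.not_inner {v : ℕ} (h : cut q b H v) : ¬ inner q b H v := fun h' => h'.2 h

lemma inner.degLeTwo (hfin : H.support.Finite) {v : ℕ} (h : inner q b H v) : DegLeTwo H v :=
  degLeTwo_of_deg_le hfin h.1.deg_le

/-- The components of the set of inner vertices have diameter at most `16q`: otherwise the middle
of a shortest path would see no cut vertex within distance `8q`. -/
lemma within_of_inner (hq : 1 ≤ q) (hfin : H.support.Finite) (hb : ∀ v ∈ H.support, v < 2 ^ b)
    {u v r : ℕ} (hu : inner q b H u) (h : Within (keep H (inner q b H)) r u v) :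
    Within (keep H (inner q b H)) (16 * q) u v := by
  obtain ⟨p, L, -, hp0, hpL, hadj, hinj, -⟩ := h.exists_geodesic
  have hseq : ∀ i ≤ L, Within (keep H (inner q b H)) i u (p i) := by
    intro i hi
    have := within_of_seq hadj 0 i (by omega)
    rwa [hp0, Nat.zero_add] at this
  by_cases hL : L ≤ 16 * q
  · rw [← hpL]
    exact (hseq L le_rfl).mono hL
  · exfalso
    have hmem : ∀ i ≤ L, inner q b H (p i) := fun i hi => (hseq i hi).mem_of_keep hu
    obtain ⟨s, hs, hW⟩ := exists_cut_within hq hfin hb (hmem (8 * q) (by omega)).1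
    have hpath : ∀ i, 0 < i → i < L → ∀ z, H.Adj (p i) z → z = p (i - 1) ∨ z = p (i + 1) := by
      intro i h0 h1 z hz
      have h2 := hadj (i - 1) (by omega)
      rw [Nat.sub_add_cancel h0] at h2
      refine (hmem i h1.le).degLeTwo hfin _ _ _ h2.1.symm (hadj i h1).1 hz fun heq => ?_
      have := hinj _ _ (by omega) (by omega) heq
      omega
    rcases within_path_or_escape hpath (by omega) (hW.mono_graph (keep_le _ _)) with
      ⟨j, -, h2, -, -, rfl⟩ | ⟨t, h1, h2⟩ | ⟨t, h1, -⟩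
    · exact hs.not_inner (hmem j h2.le)
    · obtain rfl : t = 0 := by omega
      obtain rfl := within_zero.1 h2
      exact hs.not_inner (hmem 0 (by omega))
    · omega

/-- Threads through a cluster of inner vertices are long: they join cut vertices, or a cut vertex to
a vertex outside the core, and these are far apart; or they are cycles. -/
lemma IsThread.two_mul_le (hq : 1 ≤ q) (hfin : H.support.Finite)
    (hb : ∀ v ∈ H.support, v < 2 ^ b) (hg : ((2 * q + 2 : ℕ) : ℕ∞) ≤ H.egirth) {C : Set ℕ}
    (hC : ∀ v ∈ C, inner q b H v) (hCcl : ∀ a ∈ C, ∀ c, inner q b H c → H.Adj a c → c ∈ C)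
    {p : ℕ → ℕ} {L : ℕ} (h : IsThread H C p L) : 2 * q ≤ L := by
  have h2 := h.two_le
  have hnb : ∀ i, 0 < i → i < L → ∀ z, H.Adj (p i) z → z = p (i - 1) ∨ z = p (i + 1) :=
    fun i h0 h1 z hz => h.eq_or_eq h0 h1 ((hC _ (h.mem i h0 h1)).degLeTwo hfin) hz
  have hdist : Within H L (p 0) (p L) := by
    have := within_of_seq h.adj 0 L (by omega)
    rwa [Nat.zero_add] at this
  have hend : ∀ x, x ∉ C → ∀ a ∈ C, H.Adj a x → ¬ core (2 * q) H x ∨ cut q b H x := by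
    intro x hx a ha hax
    by_contra! hcon
    exact hx (hCcl a ha x hcon hax)
  have h1C := h.mem 1 (by omega) (by omega)
  have hleft := hend _ h.left _ h1C (h.adj 0 (by omega)).symm
  have hright := hend _ h.right _ (h.mem (L - 1) (by omega) (by omega)) (by
    have := h.adj (L - 1) (by omega)
    rwa [Nat.sub_add_cancel (by omega)] at this)
  rcases hleft with hl | hl <;> rcases hright with hr | hr
  · -- the path inside the core from `p 1` to a cut vertex cannot leave the thread
    exfalso
    obtain ⟨s, hs, hW⟩ := exists_cut_within hq hfin hb (hC _ h1C).1
    have hsC := hW.mem_of_closed (Z := {z | ∃ i, 0 < i ∧ i < L ∧ z = p i})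
      ⟨1, by omega, by omega, rfl⟩ (by
        rintro _ ⟨i, h0, h1, rfl⟩ z hz
        have key : ∀ j ≤ L, z = p j → ∃ i, 0 < i ∧ i < L ∧ z = p i := by
          rintro j hj rfl
          rcases Nat.eq_zero_or_pos j with rfl | h3
          · exact absurd hz.2.2 hl
          · rcases hj.lt_or_eq with h4 | rfl
            · exact ⟨j, h3, h4, rfl⟩
            · exact absurd hz.2.2 hr
        rcases hnb i h0 h1 z hz.1 with h3 | h3
        · exact key _ (by omega) h3
        · exact key _ (by omega) h3)
    obtain ⟨i, h0, h1, rfl⟩ := hsC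
    exact hs.not_inner (hC _ (h.mem i h0 h1))
  · by_contra hlt
    exact hl (hr.1.core_of_within (hdist.symm.mono (by omega)))
  · by_contra hlt
    exact hr (hl.1.core_of_within (hdist.mono (by omega)))
  · by_cases hne : p 0 = p L
    · have := hg.trans (h.egirth_le hne)
      rw [Nat.cast_le] at this
      omega
    · by_contra hlt
      -- a vertex of degree three near an inner vertex would be near one of the ends
      have hdeep : ∀ i ≤ L, deep (2 * q) H (p i) := by
        intro i hi
        rintro ⟨z, hz, hz2⟩
        rcases within_path_or_escape hnb hi hz with
          ⟨j, h3, h4, -, -, rfl⟩ | ⟨t, h3, h4⟩ | ⟨t, h3, h4⟩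
        · have := (hC _ (h.mem j h3 h4)).1.deg_le
          omega
        · have := hl.1.deg_le (h4.mono (by omega))
          omega
        · have := hr.1.deg_le (h4.mono (by omega))
          omega
      refine net_separated hl.2 hr.2 hne ?_
      have := within_of_seq (H := keep H (deep (2 * q) H)) (p := p) (L := L)
        (fun i hi => ⟨h.adj i hi, hdeep i hi.le, hdeep (i + 1) hi⟩) 0 L (by omega)
      rw [Nat.zero_add] at this
      exact this.mono (by omega)

open Classical in
/-- The coloring in which the cut vertices have the base color. -/
noncomputable def colorCut (q b : ℕ) (H : SimpleGraph ℕ) (f : ℕ → Color q) (v : ℕ) : Color q :=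
  if cut q b H v then baseColor q else f v

/-- From a proper coloring of the compressed graph to a proper coloring of the graph. -/
lemma proper_recolor_core (hq : 1 ≤ q) (hfin : H.support.Finite)
    (hb : ∀ v ∈ H.support, v < 2 ^ b) (hg : ((2 * q + 2 : ℕ) : ℕ∞) ≤ H.egirth)
    {f : ℕ → Color q} (hf : Proper (compress (2 * q) H) f) :
    Proper H (recolor (16 * q) H fun a => (inner q b H a, colorCut q b H f a)) := by
  refine proper_recolor (fun u v r hu h => within_of_inner hq hfin hb hu h) ?_ ?_
  · intro v hv f
    set C := cluster (16 * q) H (inner q b H) v with hCdef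
    have hvC : v ∈ C := Within.refl _ _ _
    have hCin : ∀ a ∈ C, inner q b H a := fun a ha => Within.mem_of_keep ha hv
    have hCcl : ∀ a ∈ C, ∀ c, inner q b H c → H.Adj a c → c ∈ C := by
      intro a ha c hc hac
      have hk : Within (keep H (inner q b H)) 1 a c := within_of_adj ⟨hac, hCin a ha, hc⟩
      exact within_of_inner hq hfin hb hv (Within.trans ha hk)
    refine exists_extension ?_ (fun a ha => (hCin a ha).degLeTwo hfin) ?_ ?_
      (fun p L h => h.two_mul_le hq hfin hb hg hCin hCcl) f
    · refine (hfin.insert v).subset fun a ha => ?_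
      refine Within.mem_of_closed ha (Set.mem_insert _ _) fun c _ d hcd => ?_
      exact Set.mem_insert_of_mem _ ⟨c, hcd.1.symm⟩
    · rintro Z hZ ⟨z, hz⟩ hcl
      refine hZ.antisymm fun c hc => ?_
      have hzc : Within (keep H (inner q b H)) _ z c := (Within.symm (hZ hz)).trans hc
      exact hzc.mem_of_closed hz fun a ha d had =>
        hcl a ha d (hCcl a (hZ ha) d had.2.2 had.1) had.1
    · by_contra! hcon
      obtain ⟨s, hs, hW⟩ := exists_cut_within hq hfin hb hv.1
      refine hs.not_inner (hCin s (hW.mem_of_closed hvC fun a ha c hac => ?_))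
      by_contra hcC
      exact hcon c hcC a ha hac.1.symm
  · have hcore : ∀ v, ¬ inner q b H v → cut q b H v ∨ ¬ core (2 * q) H v := by
      intro v hv
      by_contra! hcon
      exact hv ⟨hcon.2, hcon.1⟩
    have hcc : ∀ u v, H.Adj u v → cut q b H u → ¬ cut q b H v := by
      intro u v huv hu hv
      refine net_separated hu.2 hv.2 huv.ne ?_
      have : Within (keep H (deep (2 * q) H)) 1 u v := within_of_adj ⟨huv, hu.1, hv.1⟩
      exact this.mono (by omega)
    have hout : ∀ u v, H.Adj u v → cut q b H u → core (2 * q) H v := fun u v huv hu =>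
      hu.1.core_of_within ((within_of_adj huv).mono (by omega))
    intro u v huv hu hv
    rcases hcore u hu with hu | hu <;> rcases hcore v hv with hv | hv
    · exact absurd hv (hcc u v huv hu)
    · exact absurd (hout u v huv hu) hv
    · exact absurd (hout v u huv.symm hv) hu
    · have hnu : ¬ cut q b H u := fun h => hu (h.1.core_of_within (Within.refl _ _ _))
      have hnv : ¬ cut q b H v := fun h => hv (h.1.core_of_within (Within.refl _ _ _))
      rw [colorCut, colorCut, if_neg hnu, if_neg hnv]
      exact hf u v ⟨huv, hu, hv⟩

end Core

/-! ### The coloring of the whole graph -/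

/-- `q` rounds of raking, followed by a compression. -/
noncomputable def phase (q : ℕ) (H : SimpleGraph ℕ) : SimpleGraph ℕ := compress (2 * q) (rake^[q] H)

/-- Extend a coloring from `rake^[i] H` to `H`. -/
noncomputable def unrake {q : ℕ} : ℕ → SimpleGraph ℕ → (ℕ → Color q) → ℕ → Color q
  | 0, _, f => f
  | i + 1, H, f => rakeColor H (unrake i (rake H) f)

/-- Extend a coloring from `phase q H` to `H`, where the identifiers have `b` bits. -/
noncomputable def unphase {q : ℕ} (b : ℕ) (H : SimpleGraph ℕ) (f : ℕ → Color q) : ℕ → Color q :=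
  unrake q H (recolor (16 * q) (rake^[q] H)
    fun a => (inner q b (rake^[q] H) a, colorCut q b (rake^[q] H) f a))

/-- The coloring that is proper if `P` phases delete all edges. -/
noncomputable def coloring (q b : ℕ) : ℕ → SimpleGraph ℕ → ℕ → Color q
  | 0, _ => fun _ => baseColor q
  | P + 1, H => unphase b H (coloring q b P (phase q H))

lemma isLocalOp_rake_iterate (i : ℕ) : IsLocalOp i rake^[i] := by
  simpa using isLocalOp_rake.iterate i

lemma isLocalOp_phase (q : ℕ) : IsLocalOp (5 * q + 1) (phase q) :=
  ((isLocalOp_compress (2 * q)).comp (isLocalOp_rake_iterate q)).mono (by omega)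

lemma isLocal_unrake {q : ℕ} (i : ℕ) {T S : ℕ} {Γ : SimpleGraph ℕ → SimpleGraph ℕ}
    (hΓ : IsLocalOp T Γ) {f : SimpleGraph ℕ → ℕ → Color q} (hf : IsLocal S f) (hS : T + i ≤ S) :
    IsLocal (S + i) fun H => unrake i (Γ H) (f H) := by
  induction i generalizing T Γ with
  | zero => exact hf
  | succ i ih =>
    have h := ih (isLocalOp_rake.comp hΓ) (by omega)
    exact ((localRule_rakeColor q).isLocal (hΓ.mono (by omega)) h).mono (by omega)

/-- The sets of cut vertices of all phases are computed in parallel, so that the factor `b` is not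
multiplied by the number of phases. -/
lemma isLocal_coloring {q : ℕ} (hq : 1 ≤ q) (b P : ℕ) :
    IsLocal (24 * q * P + (4 * b + 5) * q) (coloring q b P) := by
  induction P with
  | zero => exact fun _ _ _ _ => rfl
  | succ P ih =>
    set S := 24 * q * P + (4 * b + 5) * q + 5 * q + 1 with hS
    have hbq : (4 * b + 5) * q = (4 * b + 4) * q + q := by ring
    have h1 : IsLocal S fun H => coloring q b P (phase q H) :=
      (ih.comp (isLocalOp_phase q)).mono (by omega)
    have hr := isLocalOp_rake_iterate q
    have h2 : IsLocal S fun H => cut q b (rake^[q] H) :=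
      ((isLocal_cut hq b).comp hr).mono (by omega)
    have h3 : IsLocal S fun H => inner q b (rake^[q] H) :=
      ((isLocal_inner hq b).comp hr).mono (by omega)
    have h4 : IsLocal S fun H => colorCut q b (rake^[q] H) (coloring q b P (phase q H)) := by
      classical
      intro H H' v h
      have e1 : cut q b (rake^[q] H) v = cut q b (rake^[q] H') v := h2 H H' v h
      have e2 := h1 H H' v h
      simp only at e2
      simp only [colorCut, e1, e2]
    have h5 := (localRule_recolor q (16 * q)).isLocal (hr.mono (by omega : q ≤ S)) (h3.prodMk h4)
    have h6 := isLocal_unrake q isLocalOp_id h5 (by omega)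
    refine IsLocal.mono h6 ?_
    have : 24 * q * (P + 1) = 24 * q * P + 24 * q := by ring
    omega

lemma proper_unrake {q : ℕ} (i : ℕ) {H : SimpleGraph ℕ} (hfin : H.support.Finite)
    {f : ℕ → Color q} (hf : Proper (rake^[i] H) f) : Proper H (unrake i H f) := by
  induction i generalizing H with
  | zero => exact hf
  | succ i ih =>
    exact proper_rakeColor hfin (ih (support_mono_finite hfin (isLocalOp_rake.le H)) hf)

/-- The phases are undone one by one, starting from the graph without edges, for which every
coloring is proper. -/
lemma proper_coloring {q b : ℕ} (hq : 1 ≤ q) (P : ℕ) {H : SimpleGraph ℕ}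
    (hfin : H.support.Finite) (hb : ∀ v ∈ H.support, v < 2 ^ b)
    (hg : ((2 * q + 2 : ℕ) : ℕ∞) ≤ H.egirth) (hP : (phase q)^[P] H = ⊥) :
    Proper H (coloring q b P H) := by
  induction P generalizing H with
  | zero =>
    intro u v huv
    rw [show H = ⊥ from hP] at huv
    exact huv.elim
  | succ P ih =>
    have hle := (isLocalOp_phase q).le H
    have hr := (isLocalOp_rake_iterate q).le H
    have hsupp := SimpleGraph.support_mono hle
    have hsupp' := SimpleGraph.support_mono hr
    refine proper_unrake q hfin (proper_recolor_core hq (support_mono_finite hfin hr)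
      (fun v hv => hb v (hsupp' hv)) (hg.trans (SimpleGraph.egirth_anti hr)) ?_)
    exact ih (support_mono_finite hfin hle) (fun v hv => hb v (hsupp hv))
      (hg.trans (SimpleGraph.egirth_anti hle)) hP

/-! ### A phase deletes a constant fraction of the vertices -/

section Counting

variable {N : Finset ℕ} {H : SimpleGraph ℕ}

/-- The number of vertices that have not been isolated yet. -/
noncomputable def alive (N : Finset ℕ) (H : SimpleGraph ℕ) : ℕ := (N.filter (0 < deg H ·)).card

/-- The number of vertices of degree one. -/
noncomputable def leaves (N : Finset ℕ) (H : SimpleGraph ℕ) : ℕ := (N.filter (deg H · = 1)).card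

lemma support_finite (hN : H.support ⊆ N) : H.support.Finite := N.finite_toSet.subset hN

lemma deg_mono (hfin : H.support.Finite) {H' : SimpleGraph ℕ} (h : H' ≤ H) (v : ℕ) :
    deg H' v ≤ deg H v :=
  Set.ncard_le_ncard (fun _ hw => h hw) (finite_neighborSet hfin v)

lemma deg_pos_iff (hfin : H.support.Finite) {v : ℕ} : 0 < deg H v ↔ ∃ w, H.Adj v w :=
  Set.ncard_pos (finite_neighborSet hfin v)

lemma mem_of_deg_pos (hN : H.support ⊆ N) {v : ℕ} (h : 0 < deg H v) : v ∈ N :=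
  hN ((deg_pos_iff (support_finite hN)).1 h)

lemma two_le_deg_of_deg_rake_pos (hfin : H.support.Finite) {v : ℕ} (h : 0 < deg (rake H) v) :
    2 ≤ deg H v := by
  obtain ⟨w, hw⟩ := (deg_pos_iff (support_mono_finite hfin (isLocalOp_rake.le H))).1 h
  exact hw.2.1

lemma alive_rake_add_leaves_le (hfin : H.support.Finite) :
    alive N (rake H) + leaves N H ≤ alive N H := by
  unfold alive leaves
  rw [← Finset.card_union_of_disjoint]
  · refine Finset.card_le_card fun v hv => ?_
    simp only [Finset.mem_union, Finset.mem_filter] at hv ⊢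
    rcases hv with ⟨h1, h2⟩ | ⟨h1, h2⟩
    · exact ⟨h1, by have := two_le_deg_of_deg_rake_pos hfin h2; omega⟩
    · exact ⟨h1, by omega⟩
  · refine Finset.disjoint_filter.2 fun v _ h1 h2 => ?_
    have := two_le_deg_of_deg_rake_pos hfin h1
    omega

/-- A vertex that becomes a leaf has lost a leaf, and a leaf is lost by one vertex only. -/
lemma leaves_rake_le (hN : H.support ⊆ N) : leaves N (rake H) ≤ leaves N H := by
  have hfin := support_finite hN
  have hex : ∀ v, deg (rake H) v = 1 → ∃ w, H.Adj v w ∧ deg H w = 1 := by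
    intro v hv
    by_contra! hcon
    have h2 := two_le_deg_of_deg_rake_pos hfin (by omega : 0 < deg (rake H) v)
    have hsub : H.neighborSet v ⊆ (rake H).neighborSet v := by
      intro w hw
      have h3 : 0 < deg H w := (deg_pos_iff hfin).2 ⟨v, SimpleGraph.Adj.symm hw⟩
      have h4 := hcon w hw
      exact ⟨hw, h2, by omega⟩
    have : deg H v ≤ deg (rake H) v := Set.ncard_le_ncard hsub
      (finite_neighborSet (support_mono_finite hfin (isLocalOp_rake.le H)) v)
    omega
  choose! w hw1 hw2 using hex
  refine Finset.card_le_card_of_injOn w (fun v hv => ?_) fun v hv v' hv' hvv => ?_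
  · simp only [Finset.coe_filter, Set.mem_ofPred_eq] at hv ⊢
    exact ⟨mem_of_deg_pos hN (by rw [hw2 v hv.2]; omega), hw2 v hv.2⟩
  · simp only [Finset.coe_filter, Set.mem_ofPred_eq] at hv hv'
    refine eq_of_deg_le_one hfin (hw2 v hv.2).le (hw1 v hv.2).symm ?_
    rw [hvv]
    exact (hw1 v' hv'.2).symm

/-- After many rounds of raking, many vertices are gone or few leaves are left. -/
lemma alive_rake_iterate (hN : H.support ⊆ N) (i : ℕ) :
    alive N (rake^[i] H) + i * leaves N (rake^[i] H) ≤ alive N H := by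
  induction i with
  | zero => simp
  | succ i ih =>
    have hNi : (rake^[i] H).support ⊆ N :=
      (SimpleGraph.support_mono ((isLocalOp_rake_iterate i).le H)).trans hN
    rw [Function.iterate_succ_apply']
    have h1 := alive_rake_add_leaves_le (N := N) (support_finite hNi)
    have h2 := Nat.mul_le_mul_left (i + 1) (leaves_rake_le hNi)
    have h3 : (i + 1) * leaves N (rake^[i] H) =
      i * leaves N (rake^[i] H) + leaves N (rake^[i] H) := by ring
    omega

lemma nearby_succ {r : ℕ} {l : ℕ → Prop} {v : ℕ} :
    nearby (r + 1) H l v ↔ nearby r H l v ∨ ∃ u, H.Adj v u ∧ nearby r H l u := by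
  constructor
  · rintro ⟨z, hz, hlz⟩
    rcases within_succ.1 hz.symm with h | ⟨u, h, hu⟩
    · exact .inl ⟨z, h.symm, hlz⟩
    · exact .inr ⟨u, hu.symm, z, h.symm, hlz⟩
  · rintro (⟨z, h, hlz⟩ | ⟨u, hu, z, h, hlz⟩)
    · exact ⟨z, h.mono (Nat.le_succ r), hlz⟩
    · exact ⟨z, ((within_of_adj hu).trans h).mono (by omega), hlz⟩

lemma nearby.mono {r s : ℕ} {l : ℕ → Prop} {v : ℕ} (h : nearby r H l v) (hrs : r ≤ s) :
    nearby s H l v := by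
  obtain ⟨z, hz, hlz⟩ := h
  exact ⟨z, hz.mono hrs, hlz⟩

/-- The sum of the degrees of the vertices of degree at least three. -/
noncomputable def branching (N : Finset ℕ) (H : SimpleGraph ℕ) : ℕ :=
  ∑ v ∈ N with 2 < deg H v, deg H v

open Classical in
/-- The spheres around the set of vertices of degree at least three do not grow, since their
vertices have at most two neighbors, one of which is in the preceding sphere. -/
lemma card_sphere_le (hN : H.support ⊆ N) (j : ℕ) :
    (N.filter fun v => nearby (j + 1) H (2 < deg H ·) v ∧ ¬ nearby j H (2 < deg H ·) v).card ≤
      branching N H := by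
  have hfin := support_finite hN
  induction j with
  | zero =>
    calc _ ≤ ((N.filter (2 < deg H ·)).biUnion fun z =>
          (finite_neighborSet hfin z).toFinset).card := by
          refine Finset.card_le_card fun v hv => ?_
          obtain ⟨-, h1, h2⟩ := Finset.mem_filter.1 hv
          rcases nearby_succ.1 h1 with h | ⟨u, hu, z, hz, hdz⟩
          · exact absurd h h2
          · obtain rfl := within_zero.1 hz
            simp only [Finset.mem_biUnion, Finset.mem_filter, Set.Finite.mem_toFinset]
            exact ⟨u, ⟨mem_of_deg_pos hN (by omega), hdz⟩, hu.symm⟩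
      _ ≤ ∑ z ∈ N with 2 < deg H z, (finite_neighborSet hfin z).toFinset.card :=
          Finset.card_biUnion_le
      _ = branching N H := by
          refine Finset.sum_congr rfl fun z _ => ?_
          rw [deg, Set.ncard_eq_toFinset_card _ (finite_neighborSet hfin z)]
  | succ j ih =>
    refine le_trans ?_ ih
    have hex : ∀ v, nearby (j + 1 + 1) H (2 < deg H ·) v ∧ ¬ nearby (j + 1) H (2 < deg H ·) v →
        ∃ u, H.Adj v u ∧ nearby (j + 1) H (2 < deg H ·) u ∧ ¬ nearby j H (2 < deg H ·) u := by
      rintro v ⟨h1, h2⟩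
      rcases nearby_succ.1 h1 with h | ⟨u, hu, h⟩
      · exact absurd h h2
      · exact ⟨u, hu, h, fun h' => h2 (nearby_succ.2 (.inr ⟨u, hu, h'⟩))⟩
    choose! w hw1 hw2 hw3 using hex
    refine Finset.card_le_card_of_injOn w (fun v hv => ?_) fun v hv v' hv' hvv => ?_
    · simp only [Finset.coe_filter, Set.mem_ofPred_eq] at hv ⊢
      exact ⟨hN ⟨v, (hw1 v hv.2).symm⟩, hw2 v hv.2, hw3 v hv.2⟩
    · simp only [Finset.coe_filter, Set.mem_ofPred_eq] at hv hv'
      by_contra hne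
      have hdeg : deg H (w v) ≤ 2 := by
        by_contra hcon
        exact hw3 v hv.2 ⟨w v, Within.refl _ _ _, by omega⟩
      rcases nearby_succ.1 (hw2 v hv.2) with h | ⟨x, hx, h⟩
      · exact hw3 v hv.2 h
      · rcases degLeTwo_of_deg_le hfin hdeg v v' x (hw1 v hv.2).symm
          (hvv ▸ (hw1 v' hv'.2).symm) hx hne with rfl | rfl
        · exact hv.2.2 (h.mono (Nat.le_succ j))
        · exact hv'.2.2 (h.mono (Nat.le_succ j))

open Classical in
lemma card_nearby_le (hN : H.support ⊆ N) (j : ℕ) :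
    (N.filter fun v => nearby j H (2 < deg H ·) v).card ≤ (j + 1) * branching N H := by
  induction j with
  | zero =>
    rw [Nat.zero_add, Nat.one_mul, branching, Finset.card_eq_sum_ones]
    refine le_trans (Finset.sum_le_sum_of_subset fun v hv => ?_) (Finset.sum_le_sum fun v hv => ?_)
    · obtain ⟨h1, z, hz, hdz⟩ := Finset.mem_filter.1 hv
      obtain rfl := within_zero.1 hz
      exact Finset.mem_filter.2 ⟨h1, hdz⟩
    · have := (Finset.mem_filter.1 hv).2
      omega
  | succ j ih =>
    have hsub : (N.filter fun v => nearby (j + 1) H (2 < deg H ·) v) ⊆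
        (N.filter fun v => nearby j H (2 < deg H ·) v) ∪
        (N.filter fun v => nearby (j + 1) H (2 < deg H ·) v ∧ ¬ nearby j H (2 < deg H ·) v) := by
      intro v hv
      obtain ⟨h1, h2⟩ := Finset.mem_filter.1 hv
      by_cases h : nearby j H (2 < deg H ·) v
      · exact Finset.mem_union_left _ (Finset.mem_filter.2 ⟨h1, h⟩)
      · exact Finset.mem_union_right _ (Finset.mem_filter.2 ⟨h1, h2, h⟩)
    have h1 := (Finset.card_le_card hsub).trans (Finset.card_union_le _ _)
    have h2 := card_sphere_le hN j
    have h3 : (j + 1 + 1) * branching N H = (j + 1) * branching N H + branching N H := by ring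
    omega

/-- The vertices that survive a compression are close to a vertex of degree at least three. -/
lemma alive_compress_le (hN : H.support ⊆ N) (K : ℕ) :
    alive N (compress K H) ≤ (K + 1) * branching N H := by
  classical
  have hfin := support_finite hN
  refine le_trans (Finset.card_le_card fun v hv => ?_) (card_nearby_le hN K)
  obtain ⟨h1, h2⟩ := Finset.mem_filter.1 hv
  obtain ⟨w, hw⟩ := (deg_pos_iff (support_mono_finite hfin ((isLocalOp_compress K).le H))).1 h2
  refine Finset.mem_filter.2 ⟨h1, ?_⟩
  by_contra hcon
  exact hw.2.1 (deep.core_of_within hcon (Within.refl _ _ _))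

/-- A vertex of degree `d ≥ 3` satisfies `d ≤ 3 (d - 2)`. -/
lemma branching_le (N : Finset ℕ) (H : SimpleGraph ℕ) :
    branching N H + 6 * alive N H ≤ 3 * ∑ v ∈ N, deg H v + 3 * leaves N H := by
  rw [branching, alive, leaves, Finset.sum_filter, Finset.card_filter, Finset.card_filter,
    Finset.mul_sum, Finset.mul_sum, Finset.mul_sum, ← Finset.sum_add_distrib,
    ← Finset.sum_add_distrib]
  refine Finset.sum_le_sum fun v _ => ?_
  split_ifs <;> omega

/-- All subgraphs of `H` have average degree at most `2 + 1 / (40 q)`. Isolated vertices do not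
count. -/
def Sparse (q : ℕ) (N : Finset ℕ) (H : SimpleGraph ℕ) : Prop :=
  ∀ H' ≤ H, 40 * q * ∑ v ∈ N, deg H' v ≤ (80 * q + 1) * alive N H'

/-- If raking leaves more than `19 / 20` of the vertices, then there are few leaves in the end, so
the sum of the degrees of the branching vertices is small, and compression deletes all vertices that
are not close to a branching vertex. -/
lemma alive_phase_le {q : ℕ} (hq : 1 ≤ q) (hN : H.support ⊆ N) (hs : Sparse q N H) :
    20 * alive N (phase q H) ≤ 19 * alive N H := by
  have hle := (isLocalOp_rake_iterate q).le H
  have hNX := (SimpleGraph.support_mono hle).trans hN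
  have h1 := alive_rake_iterate hN q
  have h2 := alive_compress_le hNX (2 * q)
  have h3 := branching_le N (rake^[q] H)
  have h4 := hs _ hle
  have h5 : alive N (phase q H) ≤ alive N (rake^[q] H) := by
    refine Finset.card_le_card fun v hv => ?_
    simp only [Finset.mem_filter] at hv ⊢
    exact ⟨hv.1, hv.2.trans_le
      (deg_mono (support_finite hNX) ((isLocalOp_compress (2 * q)).le _) v)⟩
  have h6 : alive N (phase q H) ≤ 3 * (q * branching N (rake^[q] H)) := by
    refine h2.trans ?_
    rw [← Nat.mul_assoc]
    exact Nat.mul_le_mul_right _ (by omega)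
  generalize alive N (phase q H) = a'' at *
  generalize alive N (rake^[q] H) = a' at *
  generalize leaves N (rake^[q] H) = r at *
  generalize branching N (rake^[q] H) = B at *
  have h7 := Nat.mul_le_mul_left (40 * q) h3
  have h8 : 40 * (q * B) ≤ 3 * a' + 120 * (q * r) := by nlinarith
  omega

lemma Sparse.mono {q : ℕ} {H' : SimpleGraph ℕ} (h : Sparse q N H) (hle : H' ≤ H) :
    Sparse q N H' :=
  fun H'' hle' => h H'' (hle'.trans hle)

lemma alive_phase_iterate_le {q : ℕ} (hq : 1 ≤ q) (hN : H.support ⊆ N) (hs : Sparse q N H)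
    (P : ℕ) : 20 ^ P * alive N ((phase q)^[P] H) ≤ 19 ^ P * alive N H := by
  induction P with
  | zero => simp
  | succ P ih =>
    have hle := ((isLocalOp_phase q).iterate P).le H
    have h := alive_phase_le hq ((SimpleGraph.support_mono hle).trans hN) (hs.mono hle)
    rw [Function.iterate_succ_apply', pow_succ, pow_succ]
    calc 20 ^ P * 20 * alive N (phase q ((phase q)^[P] H))
        = 20 ^ P * (20 * alive N (phase q ((phase q)^[P] H))) := by ring
      _ ≤ 20 ^ P * (19 * alive N ((phase q)^[P] H)) := Nat.mul_le_mul_left _ h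
      _ = 19 * (20 ^ P * alive N ((phase q)^[P] H)) := by ring
      _ ≤ 19 * (19 ^ P * alive N H) := Nat.mul_le_mul_left _ ih
      _ = 19 ^ P * 19 * alive N H := by ring

lemma phase_iterate_eq_bot {q : ℕ} (hq : 1 ≤ q) (hN : H.support ⊆ N) (hs : Sparse q N H) {P : ℕ}
    (hP : 19 ^ P * N.card < 20 ^ P) : (phase q)^[P] H = ⊥ := by
  have hle := ((isLocalOp_phase q).iterate P).le H
  have hNP := (SimpleGraph.support_mono hle).trans hN
  have h1 := alive_phase_iterate_le hq hN hs P
  have h2 : alive N H ≤ N.card := Finset.card_filter_le _ _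
  have h3 : alive N ((phase q)^[P] H) = 0 := by
    by_contra h0
    have h4 := Nat.mul_le_mul_left (19 ^ P) h2
    have h5 := Nat.le_mul_of_pos_right (20 ^ P) (Nat.pos_of_ne_zero h0)
    omega
  rw [alive, Finset.card_eq_zero, Finset.filter_eq_empty_iff] at h3
  ext u v
  refine iff_of_false (fun h => ?_) (by simp)
  have hpos : 0 < deg ((phase q)^[P] H) u := (deg_pos_iff (support_finite hNP)).2 ⟨v, h⟩
  exact h3 (mem_of_deg_pos hNP hpos) hpos

end Counting

/-! ### Graphs whose vertices are the identifiers -/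

section Transfer

variable {V : Type*} {G : SimpleGraph V}

/-- The density condition in terms of the identifiers. -/
lemma sparse_map [Fintype V] (ι : V ↪ ℕ) {q : ℕ} (hq : 1 ≤ q)
    (hmad : mad G ≤ 2 + 1 / (40 * (q : ℝ))) :
    Sparse q (Finset.univ.map ι) (G.map ι) := by
  classical
  intro H hH
  have hHG : ∀ a b, H.Adj (ι a) (ι b) → G.Adj a b := fun a b h => by
    simpa using hH h
  have hrange : ∀ x y, H.Adj x y → ∃ a, ι a = x := fun x y h => by
    obtain ⟨a, b, -, h1, -⟩ := (SimpleGraph.map_adj ..).1 (hH h)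
    exact ⟨a, h1⟩
  have hN : H.support ⊆ (Finset.univ.map ι : Finset ℕ) := by
    rintro x ⟨y, h⟩
    obtain ⟨a, rfl⟩ := hrange x y h
    simp
  have hfin := support_finite hN
  -- the subgraph of `G` that is formed by the edges of `H`
  let S : G.Subgraph :=
    { verts := {a | ∃ b, H.Adj (ι a) (ι b)}
      Adj := fun a b => H.Adj (ι a) (ι b)
      adj_sub := fun h => hHG _ _ h
      edge_vert := fun {a b} h => ⟨b, h⟩
      symm := ⟨fun _ _ h => h.symm⟩ }
  let φ : S.verts ↪ ℕ := ⟨fun a => ι a.1, fun a b h => Subtype.ext (ι.injective h)⟩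
  have hfilter : (Finset.univ.map ι).filter (0 < deg H ·) = Finset.univ.map φ := by
    ext x
    simp only [Finset.mem_filter, Finset.mem_map, Finset.mem_univ, true_and]
    constructor
    · rintro ⟨⟨a, rfl⟩, h⟩
      obtain ⟨y, hy⟩ := (deg_pos_iff hfin).1 h
      obtain ⟨b, rfl⟩ := hrange y _ hy.symm
      exact ⟨⟨a, b, hy⟩, rfl⟩
    · rintro ⟨⟨a, b, hab⟩, rfl⟩
      exact ⟨⟨a, rfl⟩, (deg_pos_iff hfin).2 ⟨_, hab⟩⟩
  have hdeg : ∀ a : S.verts, deg H (φ a) = S.coe.degree a := by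
    intro a
    have himg : H.neighborSet (φ a) = φ '' (S.coe.neighborSet a) := by
      ext y
      constructor
      · intro hy
        obtain ⟨b, rfl⟩ := hrange y _ (SimpleGraph.Adj.symm hy)
        exact ⟨⟨b, a.1, SimpleGraph.Adj.symm hy⟩, hy, rfl⟩
      · rintro ⟨b, hb, rfl⟩
        exact hb
    rw [deg, himg, Set.ncard_image_of_injective _ φ.injective,
      ← SimpleGraph.card_neighborSet_eq_degree, Set.ncard_eq_toFinset_card', Set.toFinset_card]
  have halive : alive (Finset.univ.map ι) H = Fintype.card S.verts := by
    rw [alive, hfilter, Finset.card_map, Finset.card_univ]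
  have hsum : ∑ v ∈ Finset.univ.map ι, deg H v = 2 * S.coe.edgeSet.ncard := by
    rw [← Finset.sum_filter_of_ne (p := (0 < deg H ·)) (fun v _ h => Nat.pos_of_ne_zero h), hfilter,
      Finset.sum_map, Finset.sum_congr rfl fun a _ => hdeg a,
      SimpleGraph.sum_degrees_eq_twice_card_edges, Set.ncard_eq_toFinset_card',
      SimpleGraph.edgeFinset]
  have havg : avgDegree S.coe ≤ 2 + 1 / (40 * (q : ℝ)) :=
    (le_ciSup (f := fun S : G.Subgraph => avgDegree S.coe) (Set.finite_range _).bddAbove S).trans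
      hmad
  rw [hsum, halive]
  rw [avgDegree, Nat.card_eq_fintype_card] at havg
  have hq' : (0 : ℝ) < q := by exact_mod_cast hq
  rcases Nat.eq_zero_or_pos (Fintype.card S.verts) with h0 | h0
  · have : IsEmpty S.verts := Fintype.card_eq_zero_iff.1 h0
    have hE : S.coe.edgeSet.ncard = 0 := by
      rw [Set.ncard_eq_zero, SimpleGraph.edgeSet_eq_empty]
      exact Subsingleton.elim _ _
    rw [hE]
    simp
  · have h0' : (0 : ℝ) < Fintype.card S.verts := by exact_mod_cast h0
    rw [div_le_iff₀ h0'] at havg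
    have h1 : (40 * q * (2 * S.coe.edgeSet.ncard) : ℝ) ≤
        (80 * q + 1) * Fintype.card S.verts := by
      calc (40 * q * (2 * S.coe.edgeSet.ncard) : ℝ)
          ≤ 40 * q * ((2 + 1 / (40 * (q : ℝ))) * Fintype.card S.verts) := by gcongr
        _ = _ := by field_simp; ring
    exact_mod_cast h1

/-- Renaming the vertices does not create short cycles. -/
lemma egirth_le_egirth_map (ι : V ↪ ℕ) : G.egirth ≤ (G.map ι).egirth := by
  rw [SimpleGraph.le_egirth]
  intro x w hw
  have hmem : ∀ y ∈ w.support, y ∈ Set.range ι := by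
    intro y hy
    obtain ⟨z, hz⟩ : ∃ z, (G.map ι).Adj y z := by
      obtain ⟨e, he, hye⟩ := 
        (SimpleGraph.Walk.mem_support_iff_exists_mem_edges_of_not_nil hw.not_nil).1 hy
      obtain ⟨z, rfl⟩ := hye
      exact ⟨z, w.adj_of_mem_edges he⟩
    obtain ⟨a, b, -, h1, -⟩ := (SimpleGraph.map_adj ..).1 hz
    exact ⟨a, h1⟩
  let φ : (G.map ι).induce (Set.range ι) →g G :=
    { toFun := fun y => y.2.choose
      map_rel' := by
        intro y z h
        have h' : (G.map ι).Adj y.1 z.1 := h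
        rw [← y.2.choose_spec, ← z.2.choose_spec] at h'
        simpa using h' }
  have hφ : Function.Injective φ := by
    intro y z h
    refine Subtype.ext ?_
    rw [← y.2.choose_spec, ← z.2.choose_spec]
    exact congrArg ι h
  have hcyc : (w.induce _ hmem).IsCycle := by
    apply SimpleGraph.Walk.IsCycle.of_map (f := (SimpleGraph.Embedding.induce _).toHom)
    rw [SimpleGraph.Walk.map_induce]
    exact hw
  have h := SimpleGraph.egirth_le_length (hcyc.map hφ)
  have hlen : ((w.induce _ hmem).map φ).length = w.length := by
    rw [SimpleGraph.Walk.length_map]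
    have := congrArg SimpleGraph.Walk.length (w.map_induce hmem)
    rwa [SimpleGraph.Walk.length_map] at this
  rwa [hlen] at h

lemma Within.of_map {ι : V ↪ ℕ} {r : ℕ} {v : V} {y : ℕ} (h : Within (G.map ι) r (ι v) y) :
    ∃ a, ι a = y ∧ Within G r v a := by
  induction r generalizing y with
  | zero => exact ⟨v, within_zero.1 h, Within.refl _ _ _⟩
  | succ r ih =>
    rcases within_succ.1 h with h | ⟨z, h, hz⟩
    · obtain ⟨a, h1, h2⟩ := ih h
      exact ⟨a, h1, h2.mono (Nat.le_succ r)⟩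
    · obtain ⟨a, rfl, h2⟩ := ih h
      obtain ⟨a', b, hab, h3, rfl⟩ := (SimpleGraph.map_adj ..).1 hz
      obtain rfl := ι.injective h3
      exact ⟨b, rfl, within_succ.2 (.inr ⟨a', h2, hab⟩)⟩

end Transfer

/-! ### Local functions can be computed in the LOCAL model -/

/-- The algorithm that collects for `T` rounds all that can be known about the graph and then
evaluates `f` on the graph that is formed by the known edges. A state consists of the own identifier
and the set of the known edges. -/
def gather {Out : Type} (T : ℕ) (f : SimpleGraph ℕ → ℕ → Out) : LocalAlgorithm Out where
  State := ℕ × Set (ℕ × ℕ)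
  Msg := ℕ × Set (ℕ × ℕ)
  init i := (i, ∅)
  send s := s
  receive s M := (s.1, s.2 ∪ {e | ∃ m ∈ M, e ∈ m.2 ∨ e = (s.1, m.1)})
  rounds := T
  output s := f (SimpleGraph.fromRel fun x y => (x, y) ∈ s.2) s.1

/-- After `t` rounds a vertex knows the edges with an end within distance `t - 1`. -/
lemma stateAfter_gather {V : Type*} [Fintype V] {Out : Type} (T : ℕ)
    (f : SimpleGraph ℕ → ℕ → Out) (G : SimpleGraph V) (ident : V → ℕ) (t : ℕ) (v : V) :
    (gather T f).stateAfter G ident t v = (ident v,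
      {e | ∃ a b, G.Adj a b ∧ e = (ident a, ident b) ∧ ∃ s < t, Within G s v a}) := by
  classical
  induction t generalizing v with
  | zero => exact Prod.ext rfl (by simp [LocalAlgorithm.stateAfter, gather])
  | succ t ih =>
    have hstep : (gather T f).stateAfter G ident (t + 1) v =
        (gather T f).receive ((gather T f).stateAfter G ident t v)
        ((G.neighborFinset v).val.map fun w =>
          (gather T f).send ((gather T f).stateAfter G ident t w)) := by
      simp only [LocalAlgorithm.stateAfter]
    rw [hstep]
    simp only [ih]
    refine Prod.ext rfl (Set.ext fun e => ?_)
    simp only [gather, Set.mem_union, Set.mem_ofPred_eq, Multiset.mem_map, Finset.mem_val,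
      SimpleGraph.mem_neighborFinset]
    constructor
    · rintro (⟨a, b, h1, h2, s, h3, h4⟩ | ⟨m, ⟨w, hw, rfl⟩, ⟨a, b, h1, h2, s, h3, h4⟩ | rfl⟩)
      · exact ⟨a, b, h1, h2, s, by omega, h4⟩
      · exact ⟨a, b, h1, h2, 1 + s, by omega, (within_of_adj hw).trans h4⟩
      · exact ⟨v, w, hw, rfl, 0, by omega, Within.refl _ _ _⟩
    · rintro ⟨a, b, h1, h2, s, h3, h4⟩
      cases s with
      | zero =>
        obtain rfl := within_zero.1 h4
        exact .inr ⟨_, ⟨b, h1, rfl⟩, .inr h2⟩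
      | succ s =>
        rcases within_succ.1 h4.symm with h | ⟨w, h, hw⟩
        · exact .inl ⟨a, b, h1, h2, s, by omega, h.symm⟩
        · exact .inr ⟨_, ⟨w, hw.symm, rfl⟩, .inl ⟨a, b, h1, h2, s, by omega, h.symm⟩⟩

lemma run_gather {V : Type*} [Fintype V] {Out : Type} {T : ℕ} {f : SimpleGraph ℕ → ℕ → Out}
    (hf : IsLocal T f) (G : SimpleGraph V) (ι : V ↪ ℕ) (v : V) :
    (gather (T + 1) f).run G ι v = f (G.map ι) (ι v) := by
  rw [LocalAlgorithm.run, stateAfter_gather]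
  refine (hf _ _ _ fun x hx => ?_).symm
  obtain ⟨a, rfl, ha⟩ := hx.of_map
  ext y
  simp only [SimpleGraph.mem_neighborSet, SimpleGraph.fromRel_adj, Set.mem_ofPred_eq]
  constructor
  · intro h
    refine ⟨h.ne, .inl ?_⟩
    obtain ⟨a', b, hab, h1, rfl⟩ := (SimpleGraph.map_adj ..).1 h
    obtain rfl := ι.injective h1
    exact ⟨a', b, hab, rfl, T, Nat.lt_succ_self T, ha⟩
  · rintro ⟨-, ⟨a', b, hab, he, -⟩ | ⟨a', b, hab, he, -⟩⟩
    · rw [Prod.mk.injEq] at he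
      exact (SimpleGraph.map_adj ..).2 ⟨a', b, hab, he.1.symm, he.2.symm⟩
    · rw [Prod.mk.injEq] at he
      exact (SimpleGraph.map_adj ..).2 ⟨b, a', hab.symm, he.2.symm, he.1.symm⟩

/-! ### The number of rounds -/

/-- A number of phases that is logarithmic in the number `n` of vertices suffices. -/
lemma pow_mul_lt_pow (n : ℕ) {P : ℕ} (hP : 20 * Real.log n < P) : 19 ^ P * n < 20 ^ P := by
  rcases Nat.eq_zero_or_pos n with rfl | hn
  · simp
  · have hn' : (0 : ℝ) < n := by exact_mod_cast hn
    have h1 : (19 / 20 : ℝ) ^ P ≤ Real.exp (-(P / 20)) := by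
      calc (19 / 20 : ℝ) ^ P ≤ Real.exp (-(1 / 20)) ^ P := by
            gcongr
            have := Real.add_one_le_exp (-(1 / 20) : ℝ)
            linarith
        _ = Real.exp (-(P / 20)) := by
            rw [← Real.exp_nat_mul]
            congr 1
            ring
    have h2 : (n : ℝ) < Real.exp (P / 20) := by
      rw [← Real.log_lt_iff_lt_exp hn']
      linarith
    have h3 : (19 / 20 : ℝ) ^ P * n < 1 := by
      calc (19 / 20 : ℝ) ^ P * n ≤ Real.exp (-(P / 20)) * n := by gcongr
        _ < Real.exp (-(P / 20)) * Real.exp (P / 20) := by gcongr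
        _ = 1 := by rw [← Real.exp_add]; simp
    rw [div_pow, div_mul_eq_mul_div, div_lt_one (by positivity)] at h3
    exact_mod_cast h3

/-- Identifiers up to `n ^ c` have a number of bits that is logarithmic in `n`. -/
lemma lt_two_pow_of_le_rpow {n b i : ℕ} {c : ℝ} (hn : 0 < n) (hi : (i : ℝ) ≤ (n : ℝ) ^ c)
    (hb : 2 * c * Real.log n < b) : i < 2 ^ b := by
  have hn' : (0 : ℝ) < n := by exact_mod_cast hn
  have h2 : (1 : ℝ) / 2 ≤ Real.log 2 := by
    have := Real.log_two_gt_d9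
    linarith
  have h : (n : ℝ) ^ c < (2 : ℝ) ^ b := by
    rw [Real.rpow_def_of_pos hn', ← Real.exp_log (show (0 : ℝ) < 2 ^ b by positivity),
      Real.exp_lt_exp, Real.log_pow]
    have : (b : ℝ) * (1 / 2) ≤ b * Real.log 2 := by gcongr
    linarith
  exact_mod_cast hi.trans_lt h

end LocalFrac

theorem mainTheorem4 (c : ℝ) (hc : 1 ≤ c) :
    ∃ C : ℝ, ∀ q : ℕ, 1 ≤ q → ∀ n : ℕ,
      ∃ A : LocalFrac.LocalAlgorithm (Finset (Fin (2 * q + 1))),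
        (A.rounds : ℝ) ≤ C * ((q : ℝ) * Real.log n + (q : ℝ) ^ 2) ∧
        ∀ (V : Type*) [Fintype V] (G : SimpleGraph V),
          Fintype.card V = n →
          ((2 * q + 2 : ℕ) : ℕ∞) ≤ G.egirth →
          LocalFrac.mad G ≤ 2 + 1 / (40 * (q : ℝ)) →
          ∀ ident : V → ℕ, LocalFrac.IsIdentifierAssignment c ident →
            LocalFrac.IsPQColoring G (2 * q + 1) q (A.run G ident) := by
  -- `P ≈ 20 log n` phases of `24 q` rounds each, and `4 b q` rounds for identifiers of
  -- `b ≈ 2 c log n` bits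
  refine ⟨480 + 8 * c, fun q hq n => ?_⟩
  have hlog : 0 ≤ Real.log n := Real.log_natCast_nonneg n
  set P := ⌊20 * Real.log n⌋₊ + 1 with hP
  set b := ⌊2 * c * Real.log n⌋₊ + 1 with hb
  have hP1 : 20 * Real.log n < P := by
    rw [hP]
    push_cast
    exact Nat.lt_floor_add_one _
  have hb1 : 2 * c * Real.log n < b := by
    rw [hb]
    push_cast
    exact Nat.lt_floor_add_one _
  have hloc := LocalFrac.isLocal_coloring hq b P
  refine ⟨LocalFrac.gather (24 * q * P + (4 * b + 5) * q + 1)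
    fun H i => (LocalFrac.coloring q b P H i).1, ?_, ?_⟩
  · have hP2 : (P : ℝ) ≤ 20 * Real.log n + 1 := by
      rw [hP]
      push_cast
      gcongr
      exact Nat.floor_le (by positivity)
    have hb2 : (b : ℝ) ≤ 2 * c * Real.log n + 1 := by
      rw [hb]
      push_cast
      gcongr
      exact Nat.floor_le (by positivity)
    have hq' : (1 : ℝ) ≤ q := by exact_mod_cast hq
    change ((24 * q * P + (4 * b + 5) * q + 1 : ℕ) : ℝ) ≤ _
    push_cast
    calc (24 * q * P + (4 * b + 5) * q + 1 : ℝ)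
        ≤ 24 * q * (20 * Real.log n + 1) + (4 * (2 * c * Real.log n + 1) + 5) * q + 1 := by gcongr
      _ = (480 + 8 * c) * (q * Real.log n) + (33 * q + 1) := by ring
      _ ≤ (480 + 8 * c) * (q * Real.log n) + (480 + 8 * c) * q ^ 2 := by
          gcongr
          nlinarith
      _ = _ := by ring
  · intro V _ G hn hg hmad ident hid
    let ι : V ↪ ℕ := ⟨ident, hid.1⟩
    have hrun : ∀ v, (LocalFrac.gather (24 * q * P + (4 * b + 5) * q + 1)
        fun H i => (LocalFrac.coloring q b P H i).1).run G ident v =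
        (LocalFrac.coloring q b P (G.map ι) (ι v)).1 := fun v =>
      LocalFrac.run_gather (hloc.map Subtype.val) G ι v
    have hN : (G.map ι).support ⊆ (Finset.univ.map ι : Finset ℕ) := by
      rintro x ⟨y, h⟩
      obtain ⟨a, _, _, rfl, _⟩ := (SimpleGraph.map_adj ..).1 h
      simp
    have hbits : ∀ x ∈ (G.map ι).support, x < 2 ^ b := by
      intro x hx
      obtain ⟨a, -, rfl⟩ := Finset.mem_map.1 (hN hx)
      have hi := (hid.2 a).2
      rw [hn] at hi
      exact LocalFrac.lt_two_pow_of_le_rpow (hn ▸ Fintype.card_pos_iff.2 ⟨a⟩) hi hb1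
    have hbot := LocalFrac.phase_iterate_eq_bot hq hN (LocalFrac.sparse_map ι hq hmad) (P := P) (by
      rw [Finset.card_map, Finset.card_univ, hn]
      exact LocalFrac.pow_mul_lt_pow n hP1)
    have hproper := LocalFrac.proper_coloring hq P (LocalFrac.support_finite hN) hbits
      (hg.trans (LocalFrac.egirth_le_egirth_map ι)) hbot
    refine ⟨fun v => ?_, fun u v huv => ?_⟩
    · rw [hrun v]
      exact (LocalFrac.coloring q b P (G.map ι) (ι v)).2
    · rw [hrun u, hrun v]
      exact hproper _ _ ((SimpleGraph.map_adj ..).2 ⟨u, v, huv, rfl, rfl⟩)
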